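/- Let $\mathbb{A}$ be a commutative associative algebra with unit over $\mathbb{C}$ of finite dimension $n$, with its canonical (finite-dimensional) topology. Let $2\le k\le 2n$, let $e_1=1,e_2,\ldots,e_k\in\mathbb{A}$ be linearly independent over $\mathbb{R}$, and let $E_k=\{\sum_{j=1}^k x_je_j : x_j\in\mathbb{R}\}$ be their real linear span. Let $\Omega\subset E_k$ be a domain (nonempty, open and connected in $E_k$), and let $\Phi:\Omega\to\mathbb{A}$ be monogenic in $\Omega$, that is, $\Phi$ is continuous and for every $\zeta\in\Omega$ there is an element $\Phi'(\zeta)\in\mathbb{A}$ such that $$\lim_{\varepsilon\to 0+}\frac{\Phi(\zeta+\varepsilon h)-\Phi(\zeta)}{\varepsilon}=h\,\Phi'(\zeta)\qquad\text{for all } h\in E_k .$$ Let $\Sigma\subset\Omega$ be a compact oriented piecewise-smooth two-dimensional surface whose edge $\gamma$ is a closed rectifiable Jordan curve. Here $\Sigma$ is given by a finite oriented triangulated surface $K$ with boundary $\partial K$ and a continuous, locally injective map $f:|K|\to\Omega$ with $f(|K|)=\Sigma$ that is continuously differentiable with derivative of rank two in the interior of every triangle, and $\gamma$ being the edge of $\Sigma$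 means that $f$ maps $|\partial K|$ injectively onto $\gamma$. Then, in either direction of $\gamma$, $$\int_\gamma\Phi(\zeta)\,d\zeta=0,$$ where, with $d\zeta=e_1dx_1+\ldots+e_kdx_k$, the integral is $\sum_{j=1}^k e_j\int_\gamma\Phi\,dx_j$, understood as a limit of Riemann–Stieltjes sums over partitions of $\gamma$; in particular this limit exists. -/

import Mathlib

open Set Filter Topology

/-! ### The real span and monogenic functions -/

section Monogenic

variable {A : Type*} [NormedCommRing A] [NormedAlgebra ℂ A] {k : ℕ}

/-- The real linear span `E_k = {∑ x_j e_j : x_j ∈ ℝ}` of the vectors `e_1, …, e_k`. -/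
noncomputable abbrev realSpan (e : Fin k → A) : Submodule ℝ A := Submodule.span ℝ (Set.range e)

/-- `Φ` is monogenic in `Ω ⊆ E_k`: it is continuous there and at every `ζ ∈ Ω` it has a Gateaux
derivative, i.e. one element `d = Φ'(ζ)` of the algebra such that
`(Φ(ζ + ε h) - Φ(ζ)) ε⁻¹ → h d` as `ε → 0+`, for all `h ∈ E_k`.
Only the values of `Φ` on the open set `Ω` matter. -/
def IsMonogenicOn {e : Fin k → A} (Φ : realSpan e → A) (Ω : Set (realSpan e)) : Prop :=
  ContinuousOn Φ Ω ∧
    ∀ ζ ∈ Ω, ∃ d : A, ∀ h : realSpan e,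
      Tendsto (fun ε : ℝ => ε⁻¹ • (Φ (ζ + ε • h) - Φ ζ)) (𝓝[>] 0) (𝓝 ((h : A) * d))

end Monogenic

/-! ### Rectifiable Jordan curves and the curvilinear integral -/

/-- `γ`, restricted to `[0, 1]`, is a parametrization of a (closed) rectifiable Jordan curve:
continuous, closed, without other double points, and of finite length. -/
structure IsRectifiableJordanCurve {E : Type*} [NormedAddCommGroup E] (γ : ℝ → E) : Prop where
  continuousOn : ContinuousOn γ (Icc 0 1)
  closed : γ 0 = γ 1
  injOn : InjOn γ (Ico 0 1)
  rectifiable : BoundedVariationOn γ (Icc 0 1)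

/-- `∫_γ Φ(ζ) dζ` exists and equals `I`. The integral is the Riemann–Stieltjes integral with
respect to `dζ = ∑ e_j dx_j`: the limit of the sums `∑ Φ(γ(τ_i)) (γ(t_{i+1}) - γ(t_i))` over
tagged partitions of `[0, 1]` as the mesh tends to zero. -/
def HasCurveIntegral {A : Type*} [NormedCommRing A] [NormedAlgebra ℂ A] {k : ℕ} {e : Fin k → A}
    (Φ : realSpan e → A) (γ : ℝ → realSpan e) (I : A) : Prop :=
  ∀ ε > (0 : ℝ), ∃ δ > (0 : ℝ), ∀ (p : ℕ) (t τ : ℕ → ℝ), t 0 = 0 → t p = 1 →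
    (∀ i < p, t i ≤ τ i ∧ τ i ≤ t (i + 1) ∧ t (i + 1) - t i < δ) →
    ‖∑ i ∈ Finset.range p, Φ (γ (τ i)) * ((γ (t (i + 1)) - γ (t i) : realSpan e) : A) - I‖ < ε

/-! ### Piecewise-smooth surfaces with edge -/

/-- `v` is a vertex of the triangle `s = (a, b, c)`. -/
def IsVertexOf {V : Type*} (v : V) (s : V × V × V) : Prop :=
  v = s.1 ∨ v = s.2.1 ∨ v = s.2.2

/-- `u → v` is one of the sides `a → b`, `b → c`, `c → a` of the oriented triangle
`s = (a, b, c)`. -/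
def IsSideOf {V : Type*} (u v : V) (s : V × V × V) : Prop :=
  (u = s.1 ∧ v = s.2.1) ∨ (u = s.2.1 ∧ v = s.2.2) ∨ (u = s.2.2 ∧ v = s.1)

/-- A finite triangulated oriented surface, possibly with boundary, with vertex set
`{0, …, N - 1}`. -/
structure TriangulatedSurface (N : ℕ) where
  /-- the triangles, each listed once, as a triple of vertices in positive cyclic order -/
  tri : Finset (Fin N × Fin N × Fin N)
  nondegenerate : ∀ s ∈ tri, s.1 ≠ s.2.1 ∧ s.2.1 ≠ s.2.2 ∧ s.1 ≠ s.2.2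
  /-- distinct triangles have distinct vertex sets -/
  simplicial : ∀ s ∈ tri, ∀ t ∈ tri, (∀ v, IsVertexOf v s ↔ IsVertexOf v t) → s = t
  /-- every directed edge is a side of at most one triangle: an edge lies in at most two
  triangles, and two triangles with a common edge induce opposite directions on it -/
  oriented : ∀ s ∈ tri, ∀ t ∈ tri, ∀ u v, IsSideOf u v s → IsSideOf u v t → s = t
  /-- the triangles around a vertex form one fan: any two of them are joined by a chain of
  triangles around that vertex in which neighbours have a common edge at the vertex -/
  fan : ∀ v, ∀ s ∈ tri, ∀ t ∈ tri, IsVertexOf v s → IsVertexOf v t →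
    Relation.ReflTransGen
      (fun p q => p ∈ tri ∧ q ∈ tri ∧ IsVertexOf v p ∧ IsVertexOf v q ∧
        ∃ w, w ≠ v ∧ IsVertexOf w p ∧ IsVertexOf w q) s t

namespace TriangulatedSurface

variable {N : ℕ} (K : TriangulatedSurface N)

/-- The `a`-th unit vector of `ℝ^N`, as the point that represents the vertex `a`. -/
noncomputable def vertex (a : Fin N) : Fin N → ℝ := Pi.single a 1

/-- The geometric realization `|K| ⊆ ℝ^N`: the union of the closed triangles. -/
def carrier : Set (Fin N → ℝ) :=
  ⋃ s ∈ K.tri, convexHull ℝ {vertex s.1, vertex s.2.1, vertex s.2.2}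

/-- `{u, v}` is a boundary edge: a side `u → v` of a triangle which is not the side `v → u` of
another one. -/
def IsBoundaryEdge (u v : Fin N) : Prop :=
  (∃ s ∈ K.tri, IsSideOf u v s) ∧ ∀ s ∈ K.tri, ¬ IsSideOf v u s

/-- The boundary `|∂K|`: the union of the closed boundary edges. -/
def boundary : Set (Fin N → ℝ) :=
  {x | ∃ u v, K.IsBoundaryEdge u v ∧ x ∈ segment ℝ (vertex u) (vertex v)}

end TriangulatedSurface

/-- The point of the triangle `s` with barycentric coordinates `1 - p.1 - p.2, p.1, p.2`. -/
noncomputable def trianglePoint {N : ℕ} (s : Fin N × Fin N × Fin N) (p : ℝ × ℝ) : Fin N → ℝ :=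
  (1 - p.1 - p.2) • TriangulatedSurface.vertex s.1 + p.1 • TriangulatedSurface.vertex s.2.1 +
    p.2 • TriangulatedSurface.vertex s.2.2

/-- The open triangle in the parameter plane. -/
def openTriangle : Set (ℝ × ℝ) := {p | 0 < p.1 ∧ 0 < p.2 ∧ p.1 + p.2 < 1}

/-- `f : |K| → E` is a parametrization of a piecewise-smooth surface: continuous and locally
injective on `|K|`, and continuously differentiable with derivative of rank two inside each
triangle. Smoothness is not required up to the sides of the triangles, so that the edge of the
surface may be any rectifiable curve; self-intersections of the surface are not excluded. -/
structure IsPiecewiseSmoothSurface {E : Type*} [NormedAddCommGroup E] [NormedSpace ℝ E] {N : ℕ}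
    (K : TriangulatedSurface N) (f : (Fin N → ℝ) → E) : Prop where
  continuousOn : ContinuousOn f K.carrier
  locallyInjective : ∀ x ∈ K.carrier, ∃ U ∈ 𝓝 x, InjOn f (U ∩ K.carrier)
  smooth : ∀ s ∈ K.tri, ContDiffOn ℝ 1 (fun p => f (trianglePoint s p)) openTriangle
  regular : ∀ s ∈ K.tri, ∀ p ∈ openTriangle,
    Function.Injective (fderiv ℝ (fun q => f (trianglePoint s q)) p)

/-- The curve `γ` is the edge of the surface parametrized by `f : |K| → E`: `f` maps the boundary
`|∂K|` injectively onto the trace of `γ`. (Either direction of `γ` is allowed.) -/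
def IsEdgeOf {E : Type*} {N : ℕ} (γ : ℝ → E) (K : TriangulatedSurface N)
    (f : (Fin N → ℝ) → E) : Prop :=
  InjOn f K.boundary ∧ f '' K.boundary = γ '' Icc 0 1

/-!
A one-sided Gateaux derivative gives `Φ` partial derivatives on every triangle, so the pull-back of
`Φ dζ` to a square is a closed form in the pointwise sense, with coefficients that are continuous
but need not be differentiable. By the Looman–Menchoff theorem (Baire's theorem makes the
coefficients Lipschitz on a portion of the exceptional set, and the defect of Green's formula there
is controlled by the density of that portion) the integrals of `Φ dζ` along segments add up to zero
around small triangles. Pulled back by `f`, these integrals become a cocycle on `|K|` at small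
distances, which has a primitive on every triangle of `K`. The increments of the primitives cancel
along interior edges and vanish around each triangle, so the cocycle has no period along `|∂K|`.
Since `γ` is rectifiable, the Riemann–Stieltjes sums are close to sums of segment integrals, which
telescope around the closed curve.
-/

/-! ### The Looman–Menchoff theorem -/

section RectIntegral

open MeasureTheory intervalIntegral

variable {V : Type*} [NormedAddCommGroup V] [NormedSpace ℝ V] {P Q : ℝ × ℝ → V}

/-- The integral of the form `P dx + Q dy` along the boundary of the rectangle
`[a, b] × [c, d]`. -/
noncomputable def rectIntegral (P Q : ℝ × ℝ → V) (a b c d : ℝ) : V :=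
  (∫ x in a..b, (P (x, c) - P (x, d))) + ∫ y in c..d, (Q (b, y) - Q (a, y))

theorem rectIntegral_self_left (P Q : ℝ × ℝ → V) (a c d : ℝ) : rectIntegral P Q a a c d = 0 := by
  simp [rectIntegral]

theorem rectIntegral_self_right (P Q : ℝ × ℝ → V) (a b c : ℝ) : rectIntegral P Q a b c c = 0 := by
  simp [rectIntegral]

theorem rectIntegral_add_left (hP : Continuous P) (hQ : Continuous Q) (a m b c d : ℝ) :
    rectIntegral P Q a m c d + rectIntegral P Q m b c d = rectIntegral P Q a b c d := by
  have hPi : ∀ a b, IntervalIntegrable (fun x => P (x, c) - P (x, d)) volume a b := fun a b =>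
    Continuous.intervalIntegrable (by fun_prop) _ _
  have hQi : ∀ a b, IntervalIntegrable (fun y => Q (b, y) - Q (a, y)) volume c d := fun a b =>
    Continuous.intervalIntegrable (by fun_prop) _ _
  have hsplit : (fun y => Q (b, y) - Q (a, y)) =
      fun y => (Q (m, y) - Q (a, y)) + (Q (b, y) - Q (m, y)) := by
    ext y; abel
  unfold rectIntegral
  rw [← integral_add_adjacent_intervals (hPi a m) (hPi m b), hsplit,
    integral_add (hQi a m) (hQi m b)]
  abel

theorem rectIntegral_add_right (hP : Continuous P) (hQ : Continuous Q) (a b c m d : ℝ) :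
    rectIntegral P Q a b c m + rectIntegral P Q a b m d = rectIntegral P Q a b c d := by
  have hPi : ∀ c d, IntervalIntegrable (fun x => P (x, c) - P (x, d)) volume a b := fun c d =>
    Continuous.intervalIntegrable (by fun_prop) _ _
  have hQi : ∀ c d, IntervalIntegrable (fun y => Q (b, y) - Q (a, y)) volume c d := fun c d =>
    Continuous.intervalIntegrable (by fun_prop) _ _
  have hsplit : (fun x => P (x, c) - P (x, d)) =
      fun x => (P (x, c) - P (x, m)) + (P (x, m) - P (x, d)) := by
    ext y; abel
  unfold rectIntegral
  rw [← integral_add_adjacent_intervals (hQi c m) (hQi m d), hsplit,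
    integral_add (hPi c m) (hPi m d)]
  abel

theorem rectIntegral_quarters (hP : Continuous P) (hQ : Continuous Q) (a m b c n d : ℝ) :
    rectIntegral P Q a b c d = rectIntegral P Q a m c n + rectIntegral P Q m b c n
      + rectIntegral P Q a m n d + rectIntegral P Q m b n d := by
  rw [rectIntegral_add_left hP hQ, add_assoc, rectIntegral_add_left hP hQ,
    rectIntegral_add_right hP hQ]

theorem rectIntegral_congr {P' Q' : ℝ × ℝ → V} {a b c d : ℝ} (hab : a ≤ b) (hcd : c ≤ d)
    (hP : EqOn P P' (Icc a b ×ˢ Icc c d)) (hQ : EqOn Q Q' (Icc a b ×ˢ Icc c d)) :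
    rectIntegral P Q a b c d = rectIntegral P' Q' a b c d := by
  unfold rectIntegral
  congr 1
  · refine integral_congr fun x hx => ?_
    rw [uIcc_of_le hab] at hx
    simp only [hP (mk_mem_prod hx (left_mem_Icc.2 hcd)), hP (mk_mem_prod hx (right_mem_Icc.2 hcd))]
  · refine integral_congr fun y hy => ?_
    rw [uIcc_of_le hcd] at hy
    simp only [hQ (mk_mem_prod (left_mem_Icc.2 hab) hy), hQ (mk_mem_prod (right_mem_Icc.2 hab) hy)]

theorem rectIntegral_clm_comp {W : Type*} [NormedAddCommGroup W] [NormedSpace ℝ W]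
    [CompleteSpace V] [CompleteSpace W]
    (L : V →L[ℝ] W) (hP : Continuous P) (hQ : Continuous Q) (a b c d : ℝ) :
    rectIntegral (fun p => L (P p)) (fun p => L (Q p)) a b c d = L (rectIntegral P Q a b c d) := by
  unfold rectIntegral
  rw [map_add, ← L.intervalIntegral_comp_comm (Continuous.intervalIntegrable (by fun_prop) _ _),
    ← L.intervalIntegral_comp_comm (Continuous.intervalIntegrable (by fun_prop) _ _)]
  simp only [map_sub]

theorem continuous_integral_of_continuous {u v : ℝ → ℝ} {g : ℝ → ℝ → V} (hu : Continuous u)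
    (hv : Continuous v) (hg : Continuous (Function.uncurry g)) :
    Continuous fun t => ∫ x in (u t)..(v t), g t x := by
  have hi : ∀ t a b, IntervalIntegrable (g t) volume a b := fun t a b =>
    Continuous.intervalIntegrable (by fun_prop) _ _
  have hsub : (fun t => ∫ x in (u t)..(v t), g t x) =
      fun t => (∫ x in (0 : ℝ)..(v t), g t x) - ∫ x in (0 : ℝ)..(u t), g t x := by
    ext t
    rw [integral_interval_sub_left (hi _ _ _) (hi _ _ _)]
  rw [hsub]
  exact (continuous_parametric_intervalIntegral_of_continuous hg hv).sub
    (continuous_parametric_intervalIntegral_of_continuous hg hu)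

theorem continuous_rectIntegral (hP : Continuous P) (hQ : Continuous Q) {a b c d : ℝ → ℝ}
    (ha : Continuous a) (hb : Continuous b) (hc : Continuous c) (hd : Continuous d) :
    Continuous fun t => rectIntegral P Q (a t) (b t) (c t) (d t) := by
  refine (continuous_integral_of_continuous ha hb ?_).add
    (continuous_integral_of_continuous hc hd ?_)
  · simp only [Function.uncurry_def]; fun_prop
  · simp only [Function.uncurry_def]; fun_prop

theorem rect_induction {p : ℝ → ℝ → ℝ → ℝ → Prop}
    (quarter : ∀ a b c d, a ≤ b → c ≤ d → p a ((a + b) / 2) c ((c + d) / 2) →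
      p ((a + b) / 2) b c ((c + d) / 2) → p a ((a + b) / 2) ((c + d) / 2) d →
      p ((a + b) / 2) b ((c + d) / 2) d → p a b c d)
    (m : ℕ) : ∀ {a b c d : ℝ}, a ≤ b → c ≤ d →
      (∀ a' b' c' d', a ≤ a' → a' ≤ b' → b' ≤ b → c ≤ c' → c' ≤ d' → d' ≤ d →
        b' - a' = (b - a) / 2 ^ m → d' - c' = (d - c) / 2 ^ m → p a' b' c' d') → p a b c d := by
  induction m with
  | zero =>
    intro a b c d hab hcd h
    exact h a b c d le_rfl hab le_rfl le_rfl hcd le_rfl (by simp) (by simp)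
  | succ m ih =>
    intro a b c d hab hcd h
    refine quarter a b c d hab hcd ?_ ?_ ?_ ?_ <;>
    · refine ih (by linarith) (by linarith) fun a' b' c' d' h1 h2 h3 h4 h5 h6 h7 h8 => ?_
      refine h a' b' c' d' (by linarith) h2 (by linarith) (by linarith) h5 (by linarith) ?_ ?_
      · rw [h7, pow_succ]; field_simp; ring
      · rw [h8, pow_succ]; field_simp; ring

theorem exists_div_two_pow_lt (x y : ℝ) {ε : ℝ} (hε : 0 < ε) :
    ∃ m : ℕ, x / 2 ^ m < ε ∧ y / 2 ^ m < ε := by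
  have hlim : ∀ z : ℝ, ∀ᶠ n : ℕ in atTop, z / 2 ^ n < ε := fun z =>
    (tendsto_const_nhds.div_atTop (tendsto_pow_atTop_atTop_of_one_lt one_lt_two)).eventually
      (gt_mem_nhds hε)
  exact ((hlim x).and (hlim y)).exists

theorem dist_le_of_mem_rect {a b c d δ : ℝ} (hab : b - a ≤ δ) (hcd : d - c ≤ δ) {p q : ℝ × ℝ}
    (hp : p ∈ Icc a b ×ˢ Icc c d) (hq : q ∈ Icc a b ×ˢ Icc c d) : dist p q ≤ δ :=
  max_le ((Real.dist_le_of_mem_Icc hp.1 hq.1).trans hab)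
    ((Real.dist_le_of_mem_Icc hp.2 hq.2).trans hcd)

/-- The points near which the form `P dx + Q dy` is closed, in the sense that its integrals along
the boundaries of all small rectangles vanish. -/
def regularSet (P Q : ℝ × ℝ → V) : Set (ℝ × ℝ) :=
  {q | ∃ r > 0, ∀ a b c d, a ≤ b → c ≤ d → Icc a b ×ˢ Icc c d ⊆ Metric.ball q r →
    rectIntegral P Q a b c d = 0}

theorem isOpen_regularSet (P Q : ℝ × ℝ → V) : IsOpen (regularSet P Q) := by
  rw [Metric.isOpen_iff]
  rintro q ⟨r, hr, hq⟩
  refine ⟨r / 2, by positivity, fun q' hq' => ⟨r / 2, by positivity, fun a b c d hab hcd h =>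
    hq a b c d hab hcd (h.trans (Metric.ball_subset_ball' ?_))⟩⟩
  linarith [Metric.mem_ball.1 hq']

theorem rectIntegral_eq_zero_of_Icc_subset_regularSet (hP : Continuous P) (hQ : Continuous Q)
    {a b c d : ℝ} (hab : a ≤ b) (hcd : c ≤ d) (hR : Icc a b ×ˢ Icc c d ⊆ regularSet P Q) :
    rectIntegral P Q a b c d = 0 := by
  simp only [subset_def, regularSet, mem_ofPred_eq] at hR
  choose! r hr0 hr using hR
  obtain ⟨δ, hδ, hleb⟩ := lebesgue_number_lemma_of_metric
    (c := fun q : (Icc a b ×ˢ Icc c d : Set (ℝ × ℝ)) => Metric.ball (q : ℝ × ℝ) (r q))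
    (isCompact_Icc.prod isCompact_Icc) (fun _ => Metric.isOpen_ball)
    (fun q hq => mem_iUnion.2 ⟨⟨q, hq⟩, Metric.mem_ball_self (hr0 q hq)⟩)
  obtain ⟨m, hm₁, hm₂⟩ := exists_div_two_pow_lt (b - a) (d - c) hδ
  refine rect_induction (p := fun a b c d => rectIntegral P Q a b c d = 0) ?_ m hab hcd ?_
  · intro a b c d _ _ h1 h2 h3 h4
    simp [rectIntegral_quarters hP hQ a ((a + b) / 2) b c ((c + d) / 2) d, h1, h2, h3, h4]
  · intro a' b' c' d' ha hab' hb hc hcd' hd hba hdc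
    obtain ⟨q, hq⟩ := hleb (a', c') ⟨⟨ha, hab'.trans hb⟩, ⟨hc, hcd'.trans hd⟩⟩
    refine hr q q.2 _ _ _ _ hab' hcd' (Subset.trans (fun p hp => Metric.mem_ball.2 ?_) hq)
    exact (dist_le_of_mem_rect (hba.le.trans (le_max_left _ _)) (hdc.le.trans (le_max_right _ _))
      hp ⟨left_mem_Icc.2 hab', left_mem_Icc.2 hcd'⟩).trans_lt (max_lt hm₁ hm₂)

theorem rectIntegral_eq_zero_of_Ioo_subset_regularSet (hP : Continuous P) (hQ : Continuous Q)
    {a b c d : ℝ} (hab : a ≤ b) (hcd : c ≤ d) (hR : Ioo a b ×ˢ Ioo c d ⊆ regularSet P Q) :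
    rectIntegral P Q a b c d = 0 := by
  rcases hab.eq_or_lt with rfl | hab
  · exact rectIntegral_self_left ..
  rcases hcd.eq_or_lt with rfl | hcd
  · exact rectIntegral_self_right ..
  have hlim : Tendsto (fun t => rectIntegral P Q (a + t) (b - t) (c + t) (d - t)) (𝓝[>] 0)
      (𝓝 (rectIntegral P Q a b c d)) := by
    have hcont : Continuous fun t => rectIntegral P Q (a + t) (b - t) (c + t) (d - t) :=
      continuous_rectIntegral hP hQ (by fun_prop) (by fun_prop) (by fun_prop) (by fun_prop)
    simpa using (hcont.tendsto 0).mono_left nhdsWithin_le_nhds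
  refine tendsto_nhds_unique hlim (tendsto_const_nhds.congr' ?_)
  have hsmall : ∀ᶠ t : ℝ in 𝓝[>] 0, t < min ((b - a) / 2) ((d - c) / 2) :=
    nhdsWithin_le_nhds (gt_mem_nhds (lt_min (by linarith) (by linarith)))
  filter_upwards [hsmall, self_mem_nhdsWithin] with t ht ht0
  obtain ⟨hta, htc⟩ := lt_min_iff.1 ht
  rw [mem_Ioi] at ht0
  refine (rectIntegral_eq_zero_of_Icc_subset_regularSet hP hQ (by linarith) (by linarith)
    (Subset.trans (Set.prod_mono ?_ ?_) hR)).symm <;>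
  exact Icc_subset_Ioo (by linarith) (by linarith)

end RectIntegral

section Slices

open MeasureTheory

theorem deriv_eq_of_eqOn_of_accPt {f g : ℝ → ℝ} {s : Set ℝ} {x : ℝ} (hacc : AccPt x (𝓟 s))
    (hf : DifferentiableAt ℝ f x) (hg : DifferentiableAt ℝ g x) (hx : x ∈ s) (hfg : EqOn f g s) :
    deriv f x = deriv g x :=
  (uniqueDiffWithinAt_iff_accPt.2 hacc).eq_deriv _
    (hf.hasDerivAt.hasDerivWithinAt.congr (fun _ hy => (hfg hy).symm) (hfg hx).symm)
    hg.hasDerivAt.hasDerivWithinAt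

theorem ae_deriv_eq_of_eqOn {f g : ℝ → ℝ} {s : Set ℝ} (hf : ∀ x ∈ s, DifferentiableAt ℝ f x)
    (hg : ∀ᵐ x, DifferentiableAt ℝ g x) (hfg : EqOn f g s) :
    ∀ᵐ x, x ∈ s → deriv f x = deriv g x := by
  have hacc : ∀ᵐ x, ¬(x ∈ s ∧ 𝓝[s ∩ Ioi x] x = ⊥) :=
    (countable_setOfPred_isolated_right_within (s := s)).ae_notMem volume
  filter_upwards [hacc, hg] with x hx hgx hxs
  have hne : (𝓝[s ∩ Ioi x] x).NeBot := ⟨fun h => hx ⟨hxs, h⟩⟩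
  refine deriv_eq_of_eqOn_of_accPt ?_ (hf x hxs) hgx hxs hfg
  rw [accPt_principal_iff_nhdsWithin]
  exact hne.mono (nhdsWithin_mono x fun y hy => ⟨hy.1, hy.2.ne'⟩)

theorem lipschitzOnWith_insert_insert {q : ℝ → ℝ} {Z : Set ℝ} {M a b : ℝ} (hM : 0 ≤ M)
    (hab : a ≤ b) (hZab : Z ⊆ Icc a b) (hne : Z.Nonempty)
    (hlip : ∀ t ∈ Z, ∀ s ∈ Icc a b, |q s - q t| ≤ M * |s - t|) :
    LipschitzOnWith M.toNNReal q (insert a (insert b Z)) := by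
  have hends : |q b - q a| ≤ M * |b - a| := by
    obtain ⟨z, hz⟩ := hne
    have hza := hlip z hz a (left_mem_Icc.2 hab)
    have hzb := hlip z hz b (right_mem_Icc.2 hab)
    rw [abs_of_nonneg (sub_nonneg.2 (hZab hz).2)] at hzb
    rw [abs_sub_comm, abs_sub_comm a, abs_of_nonneg (sub_nonneg.2 (hZab hz).1)] at hza
    rw [abs_of_nonneg (sub_nonneg.2 hab)]
    linarith [abs_sub_le (q b) (q z) (q a)]
  refine LipschitzOnWith.of_dist_le_mul fun s hs t ht => ?_
  rw [Real.dist_eq, Real.dist_eq, Real.coe_toNNReal _ hM]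
  have hmem : ∀ u ∈ insert a (insert b Z), u ∈ Icc a b :=
    insert_subset (left_mem_Icc.2 hab) (insert_subset (right_mem_Icc.2 hab) hZab)
  by_cases htZ : t ∈ Z
  · exact hlip t htZ s (hmem s hs)
  by_cases hsZ : s ∈ Z
  · rw [abs_sub_comm, abs_sub_comm s]
    exact hlip s hsZ t (hmem t ht)
  simp only [mem_insert_iff, hsZ, htZ, or_false] at hs ht
  rcases hs with rfl | rfl <;> rcases ht with rfl | rfl
  · simp
  · rwa [abs_sub_comm, abs_sub_comm s]
  · exact hends
  · simp

-- The fundamental theorem of calculus is applied to a Lipschitz extension of the restriction of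
-- `q` to `Z ∪ {a, b}`.
theorem abs_sub_sub_setIntegral_deriv_le {q : ℝ → ℝ} {Z : Set ℝ} {M a b : ℝ} (hM : 0 ≤ M)
    (hab : a ≤ b) (hZ : MeasurableSet Z) (hZab : Z ⊆ Icc a b) (hne : Z.Nonempty)
    (hlip : ∀ t ∈ Z, ∀ s ∈ Icc a b, |q s - q t| ≤ M * |s - t|)
    (hdiff : ∀ t ∈ Z, DifferentiableAt ℝ q t) :
    |q b - q a - ∫ t in Ioc a b ∩ Z, deriv q t| ≤ M * volume.real (Ioc a b \ Z) := by
  obtain ⟨g, hg, hqg⟩ := (lipschitzOnWith_insert_insert hM hab hZab hne hlip).extend_real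
  have hderiv : ∀ t, ‖deriv g t‖ ≤ M := fun t => by
    simpa [hM] using norm_deriv_le_of_lipschitz (x₀ := t) hg
  have hint : IntegrableOn (deriv g) (Ioc a b) :=
    Measure.integrableOn_of_bounded (by simp) (measurable_deriv g).aestronglyMeasurable
      (.of_forall hderiv)
  have hftc : ∫ t in Ioc a b, deriv g t = q b - q a := by
    rw [← intervalIntegral.integral_of_le hab, hg.lipschitzOnWith.absolutelyContinuousOnInterval
      |>.integral_deriv_eq_sub, hqg (by simp), hqg (by simp)]
  have hon : ∫ t in Ioc a b ∩ Z, deriv q t = ∫ t in Ioc a b ∩ Z, deriv g t := by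
    refine setIntegral_congr_ae (measurableSet_Ioc.inter hZ) ?_
    filter_upwards [ae_deriv_eq_of_eqOn hdiff hg.ae_differentiableAt_real
      (hqg.mono fun t ht => by simp [ht])] with t ht hmem using ht hmem.2
  rw [hon, ← hftc, ← integral_inter_add_sdiff hZ hint, add_sub_cancel_left]
  exact norm_setIntegral_le_of_norm_le_const
    (measure_lt_top_of_subset sdiff_subset measure_Ioc_lt_top.ne) fun t _ => hderiv t

/-- `F` has difference quotients bounded by `M` at `p` in the directions of both axes, for
increments up to `κ`. -/
def AxisLipschitzAt {V : Type*} [NormedAddCommGroup V] (M κ : ℝ) (F : ℝ × ℝ → V) (p : ℝ × ℝ) :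
    Prop :=
  ∀ s, |s| ≤ κ → ‖F (p.1 + s, p.2) - F p‖ ≤ M * |s| ∧ ‖F (p.1, p.2 + s) - F p‖ ≤ M * |s|

/-- `[a, b] × [c, d]` is the smallest rectangle containing `S`: every side of it meets `S`. -/
structure IsBoundingRect (S : Set (ℝ × ℝ)) (a b c d : ℝ) : Prop where
  subset : S ⊆ Icc a b ×ˢ Icc c d
  left : ∃ y, (a, y) ∈ S
  right : ∃ y, (b, y) ∈ S
  bottom : ∃ x, (x, c) ∈ S
  top : ∃ x, (x, d) ∈ S

section AxisLipschitzAt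

variable {V : Type*} [NormedAddCommGroup V] {F : ℝ × ℝ → V} {M κ : ℝ}

theorem AxisLipschitzAt.norm_sub_le_fst {x y : ℝ} (h : AxisLipschitzAt M κ F (x, y)) {x' : ℝ}
    (hx : |x' - x| ≤ κ) : ‖F (x', y) - F (x, y)‖ ≤ M * |x' - x| := by
  simpa using (h (x' - x) hx).1

theorem AxisLipschitzAt.norm_sub_le_snd {x y : ℝ} (h : AxisLipschitzAt M κ F (x, y)) {y' : ℝ}
    (hy : |y' - y| ≤ κ) : ‖F (x, y') - F (x, y)‖ ≤ M * |y' - y| := by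
  simpa using (h (y' - y) hy).2

theorem AxisLipschitzAt.comp_swap {p : ℝ × ℝ} (h : AxisLipschitzAt M κ F p) :
    AxisLipschitzAt M κ (F ∘ Prod.swap) p.swap :=
  fun s hs => (h s hs).symm

theorem isClosed_axisLipschitzAt (hF : Continuous F) (M κ : ℝ) :
    IsClosed {p | AxisLipschitzAt M κ F p} := by
  simp only [AxisLipschitzAt, ofPred_forall, ofPred_and]
  exact isClosed_iInter fun s => isClosed_iInter fun _ =>
    (isClosed_le (by fun_prop) (by fun_prop)).inter (isClosed_le (by fun_prop) (by fun_prop))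

end AxisLipschitzAt

section IsBoundingRect

variable {S : Set (ℝ × ℝ)} {a b c d a₁ b₁ c₁ d₁ : ℝ}

theorem IsBoundingRect.swap (h : IsBoundingRect S a b c d) :
    IsBoundingRect (Prod.swap ⁻¹' S) c d a b :=
  ⟨fun _ hp => ⟨(h.subset hp).2, (h.subset hp).1⟩, h.bottom, h.top, h.left, h.right⟩

theorem IsBoundingRect.le (h : IsBoundingRect S a b c d) : a ≤ b ∧ c ≤ d := by
  obtain ⟨y, hy⟩ := h.left
  exact ⟨(h.subset hy).1.1.trans (h.subset hy).1.2, (h.subset hy).2.1.trans (h.subset hy).2.2⟩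

theorem IsBoundingRect.bounds_le (h : IsBoundingRect S a₁ b₁ c₁ d₁)
    (hS : S ⊆ Icc a b ×ˢ Icc c d) : a ≤ a₁ ∧ b₁ ≤ b ∧ c ≤ c₁ ∧ d₁ ≤ d := by
  obtain ⟨⟨_, hl⟩, ⟨_, hr⟩⟩ := And.intro h.left h.right
  obtain ⟨⟨_, hb⟩, ⟨_, ht⟩⟩ := And.intro h.bottom h.top
  exact ⟨(hS hl).1.1, (hS hr).1.2, (hS hb).2.1, (hS ht).2.2⟩

theorem exists_isBoundingRect (hS : IsCompact S) (hne : S.Nonempty) :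
    ∃ a b c d, IsBoundingRect S a b c d := by
  obtain ⟨l, hl, hlS⟩ := hS.exists_isMinOn hne continuous_fst.continuousOn
  obtain ⟨r, hr, hrS⟩ := hS.exists_isMaxOn hne continuous_fst.continuousOn
  obtain ⟨b, hb, hbS⟩ := hS.exists_isMinOn hne continuous_snd.continuousOn
  obtain ⟨t, ht, htS⟩ := hS.exists_isMaxOn hne continuous_snd.continuousOn
  exact ⟨l.1, r.1, b.2, t.2, fun p hp => ⟨⟨hlS hp, hrS hp⟩, hbS hp, htS hp⟩,
    ⟨l.2, hl⟩, ⟨r.2, hr⟩, ⟨b.1, hb⟩, ⟨t.1, ht⟩⟩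

theorem IsBoundingRect.rectIntegral_eq {V : Type*} [NormedAddCommGroup V] [NormedSpace ℝ V]
    {P Q : ℝ × ℝ → V} (h : IsBoundingRect S a₁ b₁ c₁ d₁) (hP : Continuous P) (hQ : Continuous Q)
    (hS : S ⊆ Icc a b ×ˢ Icc c d) (hreg : Icc a b ×ˢ Icc c d \ S ⊆ regularSet P Q) :
    rectIntegral P Q a b c d = rectIntegral P Q a₁ b₁ c₁ d₁ := by
  obtain ⟨ha, hb, hc, hd⟩ := h.bounds_le hS
  obtain ⟨hab, hcd⟩ := h.le
  have hzero : ∀ {a' b' c' d'}, a ≤ a' → a' ≤ b' → b' ≤ b → c ≤ c' → c' ≤ d' → d' ≤ d →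
      (∀ p ∈ S, p ∉ Ioo a' b' ×ˢ Ioo c' d') → rectIntegral P Q a' b' c' d' = 0 :=
    fun h1 h2 h3 h4 h5 h6 hoff => rectIntegral_eq_zero_of_Ioo_subset_regularSet hP hQ h2 h5
      fun p hp => hreg ⟨⟨⟨h1.trans hp.1.1.le, hp.1.2.le.trans h3⟩, h4.trans hp.2.1.le,
        hp.2.2.le.trans h6⟩, fun hpS => hoff p hpS hp⟩
  have hleft : rectIntegral P Q a a₁ c d = 0 := hzero le_rfl ha (hab.trans hb) le_rfl
    (hc.trans (hcd.trans hd)) le_rfl fun p hp hmem => hmem.1.2.not_ge (h.subset hp).1.1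
  have hright : rectIntegral P Q b₁ b c d = 0 := hzero (ha.trans hab) hb le_rfl le_rfl
    (hc.trans (hcd.trans hd)) le_rfl fun p hp hmem => hmem.1.1.not_ge (h.subset hp).1.2
  have hbottom : rectIntegral P Q a₁ b₁ c c₁ = 0 := hzero ha hab hb le_rfl hc (hcd.trans hd)
    fun p hp hmem => hmem.2.2.not_ge (h.subset hp).2.1
  have htop : rectIntegral P Q a₁ b₁ d₁ d = 0 := hzero ha hab hb (hc.trans hcd) hd le_rfl
    fun p hp hmem => hmem.2.1.not_ge (h.subset hp).2.2
  rw [← rectIntegral_add_left hP hQ a a₁ b, hleft, zero_add,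
    ← rectIntegral_add_left hP hQ a₁ b₁ b, hright, add_zero,
    ← rectIntegral_add_right hP hQ _ _ c c₁ d, hbottom, zero_add,
    ← rectIntegral_add_right hP hQ _ _ c₁ d₁ d, htop, add_zero]

end IsBoundingRect

theorem IsBoundingRect.abs_slice_sub_le {P : ℝ × ℝ → ℝ} {S : Set (ℝ × ℝ)}
    {a b c d a₁ b₁ c₁ d₁ M κ ρ x : ℝ} (hM : 0 ≤ M) (hbox : IsBoundingRect S a₁ b₁ c₁ d₁)
    (hsub : S ⊆ Icc a b ×ˢ Icc c d) (hlip : ∀ p ∈ S, AxisLipschitzAt M κ P p)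
    (hbκ : b - a ≤ κ) (hdκ : d - c ≤ κ) (hρ : b - a ≤ ρ * (d - c)) (hx : x ∈ Icc a b) :
    |P (x, d₁) - P (x, c₁)| ≤ (1 + 3 * ρ) * M * (d - c) := by
  obtain ⟨-, -, hc, hd⟩ := hbox.bounds_le hsub
  have hMρ : M * (b - a) ≤ M * (ρ * (d - c)) := mul_le_mul_of_nonneg_left hρ hM
  obtain ⟨⟨u, hu⟩, ⟨v, hv⟩⟩ := And.intro hbox.bottom hbox.top
  have hstep : ∀ {s t}, s ∈ Icc a b → t ∈ Icc a b → ∀ y, (s, y) ∈ S →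
      |P (t, y) - P (s, y)| ≤ M * (b - a) := fun hs ht y hy =>
    have := Real.dist_le_of_mem_Icc ht hs
    ((hlip _ hy).norm_sub_le_fst (this.trans hbκ)).trans (mul_le_mul_of_nonneg_left this hM)
  have hbottom := hstep (hsub hu).1 hx c₁ hu
  have htop := hstep (hsub hv).1 hx d₁ hv
  have htop' := hstep (hsub hv).1 (hsub hu).1 d₁ hv
  have hvert : |P (u, d₁) - P (u, c₁)| ≤ M * (d - c) :=
    have := Real.dist_le_of_mem_Icc ⟨hc.trans hbox.le.2, hd⟩ ⟨hc, hbox.le.2.trans hd⟩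
    ((hlip _ hu).norm_sub_le_snd (this.trans hdκ)).trans (mul_le_mul_of_nonneg_left this hM)
  rw [abs_le] at *
  constructor <;> linarith

theorem abs_slice_sub_setIntegral_deriv_le {P : ℝ × ℝ → ℝ} {S : Set (ℝ × ℝ)}
    {a b c d a₁ b₁ c₁ d₁ M κ ρ x : ℝ} (hM : 0 ≤ M) (hρ0 : 0 ≤ ρ) (hS : MeasurableSet S)
    (hbox : IsBoundingRect S a₁ b₁ c₁ d₁) (hsub : S ⊆ Icc a b ×ˢ Icc c d)
    (hlip : ∀ p ∈ S, AxisLipschitzAt M κ P p)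
    (hdiff : ∀ p ∈ S, DifferentiableAt ℝ (fun y => P (p.1, y)) p.2)
    (hbκ : b - a ≤ κ) (hdκ : d - c ≤ κ) (hρ : b - a ≤ ρ * (d - c)) (hx : x ∈ Icc a b) :
    |P (x, d₁) - P (x, c₁) - ∫ y in Ioc c₁ d₁ ∩ {y | (x, y) ∈ S}, deriv (fun y => P (x, y)) y| ≤
      (1 + 3 * ρ) * M * volume.real (Ioc c d \ {y | (x, y) ∈ S}) := by
  obtain ⟨-, -, hc, hd⟩ := hbox.bounds_le hsub
  have hcd₁ := hbox.le.2
  rcases {y | (x, y) ∈ S}.eq_empty_or_nonempty with hempty | hne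
  · rw [hempty, inter_empty, Measure.restrict_empty, integral_zero_measure, sub_zero, sdiff_empty,
      Real.volume_real_Ioc_of_le (hc.trans (hcd₁.trans hd))]
    exact hbox.abs_slice_sub_le hM hsub hlip hbκ hdκ hρ hx
  · refine (abs_sub_sub_setIntegral_deriv_le (q := fun y => P (x, y)) hM hcd₁
      (measurable_prodMk_left hS) (fun y hy => (hbox.subset hy).2) hne (fun t ht s hs =>
        (hlip _ ht).norm_sub_le_snd ((Real.dist_le_of_mem_Icc ⟨hc.trans hs.1, hs.2.trans hd⟩
          (hsub ht).2).trans hdκ)) fun t ht => hdiff _ ht).trans ?_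
    exact mul_le_mul (le_mul_of_one_le_left hM (by linarith))
      (measureReal_mono (sdiff_subset_sdiff_left (Ioc_subset_Ioc hc hd))
        (measure_lt_top_of_subset sdiff_subset measure_Ioc_lt_top.ne).ne)
      measureReal_nonneg (by positivity)

theorem setIntegral_prod_inter {α β G : Type*} [MeasurableSpace α] [MeasurableSpace β]
    [NormedAddCommGroup G] [NormedSpace ℝ G] {μ : Measure α} {ν : Measure β} [SFinite μ]
    [SFinite ν] {s : Set α} {t : Set β} {T : Set (α × β)} (hT : MeasurableSet T) {f : α × β → G}
    (hf : IntegrableOn f (s ×ˢ t ∩ T) (μ.prod ν)) :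
    IntegrableOn (fun x => ∫ y in t ∩ {y | (x, y) ∈ T}, f (x, y) ∂ν) s μ ∧
      ∫ z in s ×ˢ t ∩ T, f z ∂μ.prod ν =
        ∫ x in s, ∫ y in t ∩ {y | (x, y) ∈ T}, f (x, y) ∂ν ∂μ := by
  have hslice : ∀ x, ∫ y in t, T.indicator f (x, y) ∂ν =
      ∫ y in t ∩ {y | (x, y) ∈ T}, f (x, y) ∂ν := fun x =>
    setIntegral_indicator (f := fun y => f (x, y)) (measurable_prodMk_left hT)
  have hint : IntegrableOn (T.indicator f) (s ×ˢ t) (μ.prod ν) := by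
    rwa [IntegrableOn, integrable_indicator_iff hT, IntegrableOn, Measure.restrict_restrict hT,
      inter_comm]
  simp only [← hslice, ← setIntegral_indicator hT, setIntegral_prod _ hint, and_true]
  rw [IntegrableOn, ← Measure.prod_restrict] at hint
  exact hint.integral_prod_left

theorem measureReal_Ioc_prod_Ioc_sdiff {S : Set (ℝ × ℝ)} (hS : MeasurableSet S) (a b c d : ℝ) :
    IntegrableOn (fun x => volume.real (Ioc c d \ {y | (x, y) ∈ S})) (Ioc a b) ∧
      volume.real (Ioc a b ×ˢ Ioc c d \ S) =
        ∫ x in Ioc a b, volume.real (Ioc c d \ {y | (x, y) ∈ S}) := by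
  have hfin : volume (Ioc a b ×ˢ Ioc c d ∩ Sᶜ) ≠ ⊤ :=
    (((Metric.isBounded_Ioc a b).prod (Metric.isBounded_Ioc c d)).subset
      inter_subset_left).measure_lt_top.ne
  have h := setIntegral_prod_inter hS.compl (integrableOn_const (C := (1 : ℝ)) (hs := hfin))
  simp only [setIntegral_const, smul_eq_mul, mul_one] at h
  exact h

theorem AxisLipschitzAt.norm_deriv_snd_le {F : ℝ × ℝ → ℝ} {M κ : ℝ} {p : ℝ × ℝ} (hM : 0 ≤ M)
    (hκ : 0 < κ) (h : AxisLipschitzAt M κ F p) : ‖deriv (fun y => F (p.1, y)) p.2‖ ≤ M := by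
  refine norm_deriv_le_of_lip' hM ?_
  filter_upwards [Metric.closedBall_mem_nhds p.2 hκ] with y hy using h.norm_sub_le_snd hy

theorem IsBoundingRect.abs_integral_sub_setIntegral_deriv_le {P : ℝ × ℝ → ℝ} (hP : Continuous P)
    {S : Set (ℝ × ℝ)} {a b c d a₁ b₁ c₁ d₁ M κ ρ : ℝ} (hM : 0 ≤ M) (hκ : 0 < κ) (hρ0 : 0 ≤ ρ)
    (hS : MeasurableSet S)
    (hbox : IsBoundingRect S a₁ b₁ c₁ d₁) (hsub : S ⊆ Icc a b ×ˢ Icc c d)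
    (hlip : ∀ p ∈ S, AxisLipschitzAt M κ P p)
    (hdiff : ∀ p ∈ S, DifferentiableAt ℝ (fun y => P (p.1, y)) p.2)
    (hbκ : b - a ≤ κ) (hdκ : d - c ≤ κ) (hρ : b - a ≤ ρ * (d - c)) :
    |(∫ x in a₁..b₁, (P (x, d₁) - P (x, c₁))) -
        ∫ p in Ioc a₁ b₁ ×ˢ Ioc c₁ d₁ ∩ S, deriv (fun y => P (p.1, y)) p.2| ≤
      (1 + 3 * ρ) * M * volume.real (Ioc a b ×ˢ Ioc c d \ S) := by
  obtain ⟨ha, hb, -, -⟩ := hbox.bounds_le hsub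
  have hfin : volume (Ioc a₁ b₁ ×ˢ Ioc c₁ d₁ ∩ S) < ⊤ :=
    (((Metric.isBounded_Ioc a₁ b₁).prod (Metric.isBounded_Ioc c₁ d₁)).subset
      inter_subset_left).measure_lt_top
  have hderiv : IntegrableOn (fun p : ℝ × ℝ => deriv (fun y => P (p.1, y)) p.2)
      (Ioc a₁ b₁ ×ˢ Ioc c₁ d₁ ∩ S) :=
    Measure.integrableOn_of_bounded hfin.ne
      (measurable_deriv_with_param (f := fun x y => P (x, y)) hP).aestronglyMeasurable <|
      (ae_restrict_iff' ((measurableSet_Ioc.prod measurableSet_Ioc).inter hS)).2 <|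
        .of_forall fun p hp => (hlip p hp.2).norm_deriv_snd_le hM hκ
  obtain ⟨hinner, houter⟩ := setIntegral_prod_inter hS hderiv
  obtain ⟨hvol, hvol'⟩ := measureReal_Ioc_prod_Ioc_sdiff hS a b c d
  have hcont : IntegrableOn (fun x => P (x, d₁) - P (x, c₁)) (Ioc a₁ b₁) :=
    (Continuous.integrableOn_Icc (by fun_prop)).mono_set Ioc_subset_Icc_self
  rw [intervalIntegral.integral_of_le hbox.le.1, hvol', Measure.volume_eq_prod, houter,
    ← integral_sub hcont hinner, ← integral_const_mul, ← Real.norm_eq_abs]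
  refine le_trans (norm_integral_le_of_norm_le
    ((hvol.mono_set (Ioc_subset_Ioc ha hb)).const_mul _) <|
    (ae_restrict_iff' measurableSet_Ioc).2 <| .of_forall fun x hx =>
      abs_slice_sub_setIntegral_deriv_le hM hρ0 hS hbox hsub hlip hdiff hbκ hdκ hρ
        ⟨ha.trans hx.1.le, hx.2.trans hb⟩) ?_
  exact setIntegral_mono_set (hvol.const_mul _) (.of_forall fun x => by positivity)
    (Ioc_subset_Ioc ha hb).eventuallyLE

theorem IsBoundingRect.abs_integral_sub_setIntegral_deriv_swap_le {Q : ℝ × ℝ → ℝ}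
    (hQ : Continuous Q) {S : Set (ℝ × ℝ)} {a b c d a₁ b₁ c₁ d₁ M κ ρ : ℝ} (hM : 0 ≤ M)
    (hκ : 0 < κ) (hρ0 : 0 ≤ ρ) (hS : MeasurableSet S) (hbox : IsBoundingRect S a₁ b₁ c₁ d₁)
    (hsub : S ⊆ Icc a b ×ˢ Icc c d) (hlip : ∀ p ∈ S, AxisLipschitzAt M κ Q p)
    (hdiff : ∀ p ∈ S, DifferentiableAt ℝ (fun x => Q (x, p.2)) p.1)
    (hbκ : b - a ≤ κ) (hdκ : d - c ≤ κ) (hρ : d - c ≤ ρ * (b - a)) :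
    |(∫ y in c₁..d₁, (Q (b₁, y) - Q (a₁, y))) -
        ∫ p in Ioc a₁ b₁ ×ˢ Ioc c₁ d₁ ∩ S, deriv (fun x => Q (x, p.2)) p.1| ≤
      (1 + 3 * ρ) * M * volume.real (Ioc a b ×ˢ Ioc c d \ S) := by
  have hswap : MeasurePreserving (Prod.swap : ℝ × ℝ → ℝ × ℝ) := Measure.measurePreserving_swap
  have key : |(∫ y in c₁..d₁, (Q (b₁, y) - Q (a₁, y))) -
      ∫ p in Ioc c₁ d₁ ×ˢ Ioc a₁ b₁ ∩ Prod.swap ⁻¹' S, deriv (fun x => Q (x, p.swap.2)) p.swap.1| ≤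
      (1 + 3 * ρ) * M * volume.real (Ioc c d ×ˢ Ioc a b \ Prod.swap ⁻¹' S) :=
    hbox.swap.abs_integral_sub_setIntegral_deriv_le (hQ.comp continuous_swap) hM hκ hρ0
    (measurable_swap hS) (fun p hp => ⟨(hsub hp).2, (hsub hp).1⟩)
    (fun p hp => (hlip p.swap hp).comp_swap) (fun p hp => hdiff p.swap hp) hdκ hbκ hρ
  rwa [← preimage_swap_prod (Ioc a₁ b₁), ← preimage_swap_prod (Ioc a b), ← preimage_inter,
    ← preimage_sdiff, hswap.measureReal_preimage ((measurableSet_Ioc.prod measurableSet_Ioc).diff hS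
      |>.nullMeasurableSet), hswap.setIntegral_preimage_emb
      MeasurableEquiv.prodComm.measurableEmbedding
      (fun p : ℝ × ℝ => deriv (fun x => Q (x, p.2)) p.1)] at key

theorem abs_rectIntegral_le_volume_sdiff {P Q : ℝ × ℝ → ℝ} (hP : Continuous P)
    (hQ : Continuous Q) {S : Set (ℝ × ℝ)} (hS : IsClosed S) {a b c d M κ ρ : ℝ} (hM : 0 ≤ M)
    (hκ : 0 < κ) (hρ0 : 0 ≤ ρ)
    (hlipP : ∀ p ∈ S, AxisLipschitzAt M κ P p) (hlipQ : ∀ p ∈ S, AxisLipschitzAt M κ Q p)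
    (hdiffP : ∀ p ∈ S, DifferentiableAt ℝ (fun y => P (p.1, y)) p.2)
    (hdiffQ : ∀ p ∈ S, DifferentiableAt ℝ (fun x => Q (x, p.2)) p.1)
    (hPQ : ∀ p ∈ S, deriv (fun y => P (p.1, y)) p.2 = deriv (fun x => Q (x, p.2)) p.1)
    (hbκ : b - a ≤ κ) (hdκ : d - c ≤ κ) (hρ : b - a ≤ ρ * (d - c)) (hρ' : d - c ≤ ρ * (b - a))
    (hne : (S ∩ Icc a b ×ˢ Icc c d).Nonempty) (hreg : Icc a b ×ˢ Icc c d \ S ⊆ regularSet P Q) :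
    |rectIntegral P Q a b c d| ≤
      2 * ((1 + 3 * ρ) * M) * volume.real (Ioc a b ×ˢ Ioc c d \ S) := by
  set T := S ∩ Icc a b ×ˢ Icc c d with hT
  have hTR : T ⊆ Icc a b ×ˢ Icc c d := inter_subset_right
  have hTS : ∀ {p}, p ∈ T → p ∈ S := And.left
  have hTc : IsCompact T := (isCompact_Icc.prod isCompact_Icc).inter_left hS
  have hdiffT : Ioc a b ×ˢ Ioc c d \ S = Ioc a b ×ˢ Ioc c d \ T := by
    rw [hT, sdiff_inter, sdiff_eq_empty.2 (Set.prod_mono Ioc_subset_Icc_self Ioc_subset_Icc_self),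
      union_empty]
  obtain ⟨a₁, b₁, c₁, d₁, hbox⟩ := exists_isBoundingRect hTc hne
  have hboundP := hbox.abs_integral_sub_setIntegral_deriv_le hP hM hκ hρ0 hTc.measurableSet hTR
    (fun p hp => hlipP p (hTS hp)) (fun p hp => hdiffP p (hTS hp)) hbκ hdκ hρ
  have hboundQ := hbox.abs_integral_sub_setIntegral_deriv_swap_le hQ hM hκ hρ0 hTc.measurableSet
    hTR (fun p hp => hlipQ p (hTS hp)) (fun p hp => hdiffQ p (hTS hp)) hbκ hdκ hρ'
  rw [← setIntegral_congr_fun ((measurableSet_Ioc.prod measurableSet_Ioc).inter hTc.measurableSet)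
    fun p hp => hPQ p (hTS hp.2)] at hboundQ
  have hneg : ∫ x in a₁..b₁, (P (x, c₁) - P (x, d₁)) =
      -∫ x in a₁..b₁, (P (x, d₁) - P (x, c₁)) := by
    rw [← intervalIntegral.integral_neg]; simp only [neg_sub]
  rw [hbox.rectIntegral_eq hP hQ hTR (by rwa [hT, sdiff_inter, sdiff_self,
    union_empty]), rectIntegral, hneg, hdiffT]
  rw [abs_le] at *
  constructor <;> linarith

theorem measureReal_Ioc_prod_Ioc_quarters (ν : Measure (ℝ × ℝ)) [IsFiniteMeasure ν]
    {a m b c n d : ℝ} (ham : a ≤ m) (hmb : m ≤ b) (hcn : c ≤ n) (hnd : n ≤ d) :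
    ν.real (Ioc a b ×ˢ Ioc c d) = ν.real (Ioc a m ×ˢ Ioc c n) + ν.real (Ioc m b ×ˢ Ioc c n)
      + ν.real (Ioc a m ×ˢ Ioc n d) + ν.real (Ioc m b ×ˢ Ioc n d) := by
  have hsplit : ∀ c d, ν.real (Ioc a b ×ˢ Ioc c d) =
      ν.real (Ioc a m ×ˢ Ioc c d) + ν.real (Ioc m b ×ˢ Ioc c d) := fun c d => by
    rw [← Ioc_union_Ioc_eq_Ioc ham hmb, union_prod, measureReal_union
      (Disjoint.set_prod_left (Ioc_disjoint_Ioc_of_le le_rfl) _ _)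
      (measurableSet_Ioc.prod measurableSet_Ioc)]
  rw [← Ioc_union_Ioc_eq_Ioc hcn hnd, prod_union, measureReal_union
    (Disjoint.set_prod_right (Ioc_disjoint_Ioc_of_le le_rfl) _ _)
    (measurableSet_Ioc.prod measurableSet_Ioc), hsplit, hsplit, add_assoc (_ + _)]

theorem norm_rectIntegral_le_of_dyadic {V : Type*} [NormedAddCommGroup V] [NormedSpace ℝ V]
    {P Q : ℝ × ℝ → V} (hP : Continuous P) (hQ : Continuous Q) (ν : Measure (ℝ × ℝ))
    [IsFiniteMeasure ν] {a b c d C : ℝ} (hab : a ≤ b) (hcd : c ≤ d) (m : ℕ)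
    (hle : ∀ a' b' c' d', a ≤ a' → a' ≤ b' → b' ≤ b → c ≤ c' → c' ≤ d' → d' ≤ d →
      b' - a' = (b - a) / 2 ^ m → d' - c' = (d - c) / 2 ^ m →
      ‖rectIntegral P Q a' b' c' d'‖ ≤ C * ν.real (Ioc a' b' ×ˢ Ioc c' d')) :
    ‖rectIntegral P Q a b c d‖ ≤ C * ν.real (Ioc a b ×ˢ Ioc c d) := by
  refine rect_induction (p := fun a b c d => ‖rectIntegral P Q a b c d‖ ≤
    C * ν.real (Ioc a b ×ˢ Ioc c d)) (fun a b c d hab hcd h₁ h₂ h₃ h₄ => ?_) m hab hcd hle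
  rw [rectIntegral_quarters hP hQ a ((a + b) / 2) b c ((c + d) / 2) d,
    measureReal_Ioc_prod_Ioc_quarters ν (m := (a + b) / 2) (n := (c + d) / 2) (by linarith)
      (by linarith) (by linarith) (by linarith), mul_add, mul_add, mul_add]
  exact norm_add₄_le.trans (by gcongr)

theorem tendsto_measureReal_cthickening_sdiff {S : Set (ℝ × ℝ)} (hS : IsCompact S) :
    Tendsto (fun δ => volume.real (Metric.cthickening δ S \ S)) (𝓝 0) (𝓝 0) := by
  have hfin : ∀ δ, volume (Metric.cthickening δ S) ≠ ⊤ := fun δ =>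
    hS.isBounded.cthickening.measure_lt_top.ne
  have hlim := ((ENNReal.tendsto_toReal hS.measure_ne_top).comp
    (tendsto_measure_cthickening_of_isCompact (μ := volume) hS)).sub_const (volume.real S)
  rw [← Measure.real, sub_self] at hlim
  refine hlim.congr fun δ => ?_
  rw [measureReal_sdiff (Metric.self_subset_cthickening S) hS.measurableSet (hfin δ)]
  rfl

theorem norm_rectIntegral_le_volume_cthickening_sdiff {V : Type*} [NormedAddCommGroup V]
    [NormedSpace ℝ V] {P Q : ℝ × ℝ → V} (hP : Continuous P) (hQ : Continuous Q)
    {S : Set (ℝ × ℝ)} (hS : Bornology.IsBounded S) {a b c d C δ : ℝ} (hab : a ≤ b) (hcd : c ≤ d)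
    (hC : 0 ≤ C) (hreg : Icc a b ×ˢ Icc c d \ S ⊆ regularSet P Q) {m : ℕ}
    (hbm : (b - a) / 2 ^ m ≤ δ) (hdm : (d - c) / 2 ^ m ≤ δ)
    (hle : ∀ a' b' c' d', a ≤ a' → a' ≤ b' → b' ≤ b → c ≤ c' → c' ≤ d' → d' ≤ d →
      b' - a' = (b - a) / 2 ^ m → d' - c' = (d - c) / 2 ^ m →
      (S ∩ Icc a' b' ×ˢ Icc c' d').Nonempty →
      ‖rectIntegral P Q a' b' c' d'‖ ≤ C * volume.real (Ioc a' b' ×ˢ Ioc c' d' \ S)) :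
    ‖rectIntegral P Q a b c d‖ ≤ C * volume.real (Metric.cthickening δ S \ S) := by
  set T := Metric.cthickening δ S \ S
  have : IsFiniteMeasure (volume.restrict T) :=
    isFiniteMeasure_restrict.2 (measure_lt_top_of_subset sdiff_subset
      hS.cthickening.measure_lt_top.ne).ne
  refine (norm_rectIntegral_le_of_dyadic hP hQ (volume.restrict T) (C := C) hab hcd m ?_).trans
    (mul_le_mul_of_nonneg_left ((measureReal_mono (subset_univ _)).trans_eq
      (by rw [measureReal_restrict_apply .univ, univ_inter])) hC)
  intro a' b' c' d' h₁ h₂ h₃ h₄ h₅ h₆ h₇ h₈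
  rcases (S ∩ Icc a' b' ×ˢ Icc c' d').eq_empty_or_nonempty with hempty | hne
  · rw [rectIntegral_eq_zero_of_Icc_subset_regularSet hP hQ h₂ h₅ fun p hp => hreg
      ⟨⟨⟨h₁.trans hp.1.1, hp.1.2.trans h₃⟩, h₄.trans hp.2.1, hp.2.2.trans h₆⟩,
        fun hpS => hempty.subset ⟨hpS, hp⟩⟩, norm_zero]
    positivity
  · refine (hle a' b' c' d' h₁ h₂ h₃ h₄ h₅ h₆ h₇ h₈ hne).trans
      (mul_le_mul_of_nonneg_left ?_ hC)
    obtain ⟨q, hqS, hq⟩ := hne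
    rw [measureReal_restrict_apply (measurableSet_Ioc.prod measurableSet_Ioc)]
    refine measureReal_mono (fun p hp => ⟨hp.1, Metric.mem_cthickening_of_dist_le _ q _ _ hqS
      (dist_le_of_mem_rect (h₇.trans_le hbm) (h₈.trans_le hdm)
        ⟨Ioc_subset_Icc_self hp.1.1, Ioc_subset_Icc_self hp.1.2⟩ hq), hp.2⟩) ?_
    exact (((Metric.isBounded_Ioc a' b').prod (Metric.isBounded_Ioc c' d')).subset
      inter_subset_left).measure_lt_top.ne

theorem rectIntegral_eq_zero_of_norm_le_volume_sdiff {V : Type*} [NormedAddCommGroup V]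
    [NormedSpace ℝ V] {P Q : ℝ × ℝ → V} (hP : Continuous P) (hQ : Continuous Q)
    {S : Set (ℝ × ℝ)} (hS : IsCompact S) {a b c d C : ℝ} (hab : a ≤ b) (hcd : c ≤ d) (hC : 0 ≤ C)
    (hreg : Icc a b ×ˢ Icc c d \ S ⊆ regularSet P Q)
    (hle : ∀ (m : ℕ) a' b' c' d', a ≤ a' → a' ≤ b' → b' ≤ b → c ≤ c' → c' ≤ d' → d' ≤ d →
      b' - a' = (b - a) / 2 ^ m → d' - c' = (d - c) / 2 ^ m →
      (S ∩ Icc a' b' ×ˢ Icc c' d').Nonempty →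
      ‖rectIntegral P Q a' b' c' d'‖ ≤ C * volume.real (Ioc a' b' ×ˢ Ioc c' d' \ S)) :
    rectIntegral P Q a b c d = 0 := by
  have hδ : ∀ δ > 0, ‖rectIntegral P Q a b c d‖ ≤
      C * volume.real (Metric.cthickening δ S \ S) := fun δ hδ => by
    obtain ⟨m, hbm, hdm⟩ := exists_div_two_pow_lt (b - a) (d - c) hδ
    exact norm_rectIntegral_le_volume_cthickening_sdiff hP hQ hS.isBounded hab hcd hC hreg hbm.le
      hdm.le (hle m)
  have hlim : Tendsto (fun δ => C * volume.real (Metric.cthickening δ S \ S)) (𝓝[>] 0)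
      (𝓝 0) := by
    simpa using ((tendsto_measureReal_cthickening_sdiff hS).const_mul C).mono_left
      nhdsWithin_le_nhds
  exact norm_le_zero_iff.1 (ge_of_tendsto hlim (eventually_mem_nhdsWithin.mono hδ))

theorem rectIntegral_eq_zero_of_axisLipschitzAt {P Q : ℝ × ℝ → ℝ} (hP : Continuous P)
    (hQ : Continuous Q) {S : Set (ℝ × ℝ)} (hS : IsCompact S) {a b c d M κ : ℝ} (hM : 0 ≤ M)
    (hκ : 0 < κ) (hlipP : ∀ p ∈ S, AxisLipschitzAt M κ P p)
    (hlipQ : ∀ p ∈ S, AxisLipschitzAt M κ Q p)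
    (hdiffP : ∀ p ∈ S, DifferentiableAt ℝ (fun y => P (p.1, y)) p.2)
    (hdiffQ : ∀ p ∈ S, DifferentiableAt ℝ (fun x => Q (x, p.2)) p.1)
    (hPQ : ∀ p ∈ S, deriv (fun y => P (p.1, y)) p.2 = deriv (fun x => Q (x, p.2)) p.1)
    (hab : a ≤ b) (hcd : c ≤ d) (hbκ : b - a ≤ κ) (hdκ : d - c ≤ κ)
    (hreg : Icc a b ×ˢ Icc c d \ S ⊆ regularSet P Q) :
    rectIntegral P Q a b c d = 0 := by
  rcases hab.eq_or_lt with rfl | hab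
  · exact rectIntegral_self_left ..
  rcases hcd.eq_or_lt with rfl | hcd
  · exact rectIntegral_self_right ..
  have hw : 0 < b - a := sub_pos.2 hab
  have hh : 0 < d - c := sub_pos.2 hcd
  obtain ⟨ρ, hρ0, hρ, hρ'⟩ : ∃ ρ, 0 ≤ ρ ∧ b - a ≤ ρ * (d - c) ∧ d - c ≤ ρ * (b - a) := by
    refine ⟨(b - a) / (d - c) + (d - c) / (b - a), by positivity, ?_, ?_⟩
    · rw [add_mul, div_mul_cancel₀ _ hh.ne']; exact le_add_of_nonneg_right (by positivity)
    · rw [add_mul, div_mul_cancel₀ _ hw.ne']; exact le_add_of_nonneg_left (by positivity)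
  refine rectIntegral_eq_zero_of_norm_le_volume_sdiff hP hQ hS hab.le hcd.le
    (C := 2 * ((1 + 3 * ρ) * M)) (by positivity) hreg
    fun m a' b' c' d' ha _ hb hc _ hd hw' hh' hne => ?_
  refine abs_rectIntegral_le_volume_sdiff hP hQ hS.isClosed hM hκ hρ0
    hlipP hlipQ hdiffP hdiffQ hPQ (by linarith) (by linarith) ?_ ?_ hne fun p hp => hreg
      ⟨⟨⟨ha.trans hp.1.1.1, hp.1.1.2.trans hb⟩, hc.trans hp.1.2.1, hp.1.2.2.trans hd⟩, hp.2⟩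
  · rw [hw', hh', ← mul_div_assoc]; gcongr
  · rw [hw', hh', ← mul_div_assoc]; gcongr

end Slices

section Baire

/-- Both partial derivatives of `F` exist at `p`. -/
def PartiallyDifferentiableAt {V : Type*} [NormedAddCommGroup V] [NormedSpace ℝ V]
    (F : ℝ × ℝ → V) (p : ℝ × ℝ) : Prop :=
  DifferentiableAt ℝ (fun x => F (x, p.2)) p.1 ∧ DifferentiableAt ℝ (fun y => F (p.1, y)) p.2

theorem eventuallyEq_slices {α : Type*} {F G : ℝ × ℝ → α} {p : ℝ × ℝ} (hFG : F =ᶠ[𝓝 p] G) :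
    (fun x => F (x, p.2)) =ᶠ[𝓝 p.1] (fun x => G (x, p.2)) ∧
      (fun y => F (p.1, y)) =ᶠ[𝓝 p.2] fun y => G (p.1, y) :=
  ⟨(Continuous.prodMk_left p.2).continuousAt.eventually hFG,
    (Continuous.prodMk_right p.1).continuousAt.eventually hFG⟩

variable {V : Type*} [NormedAddCommGroup V]

theorem AxisLipschitzAt.mono {F : ℝ × ℝ → V} {p : ℝ × ℝ} {M M' κ κ' : ℝ}
    (h : AxisLipschitzAt M κ F p) (hM : M ≤ M') (hκ : κ' ≤ κ) : AxisLipschitzAt M' κ' F p :=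
  fun s hs => ⟨(h s (hs.trans hκ)).1.trans (by gcongr), (h s (hs.trans hκ)).2.trans (by gcongr)⟩

theorem exists_continuous_eqOn_rect {F : ℝ × ℝ → V} {a b c d : ℝ} (hab : a ≤ b) (hcd : c ≤ d)
    (hF : ContinuousOn F (Icc a b ×ˢ Icc c d)) :
    ∃ G : ℝ × ℝ → V, Continuous G ∧ EqOn F G (Icc a b ×ˢ Icc c d) := by
  refine ⟨fun p => F (projIcc a b hab p.1, projIcc c d hcd p.2),
    hF.comp_continuous (by fun_prop) fun p => ⟨Subtype.prop _, Subtype.prop _⟩, fun p hp => ?_⟩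
  simp only [projIcc_of_mem hab hp.1, projIcc_of_mem hcd hp.2]

variable [NormedSpace ℝ V]

theorem exists_nat_forall_norm_sub_le {f : ℝ → V} {x : ℝ} (hf : DifferentiableAt ℝ f x) :
    ∃ n : ℕ, ∀ m ≥ n, ∀ s, |s| ≤ 1 / ((m : ℝ) + 1) → ‖f (x + s) - f x‖ ≤ (m + 1) * |s| := by
  obtain ⟨c, hc⟩ := hf.isBigO_sub.bound
  obtain ⟨ε, hε, hbound⟩ := Metric.eventually_nhds_iff.1 hc
  obtain ⟨n₁, hn₁⟩ := exists_nat_gt c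
  obtain ⟨n₂, hn₂⟩ := exists_nat_one_div_lt hε
  refine ⟨max n₁ n₂, fun m hm s hs => ?_⟩
  have hm₁ : (n₁ : ℝ) ≤ m := mod_cast (le_max_left _ _).trans hm
  have hm₂ : (n₂ : ℝ) ≤ m := mod_cast (le_max_right _ _).trans hm
  have hsε : |s| < ε := (hs.trans (one_div_le_one_div_of_le (by positivity) (by gcongr))).trans_lt
    hn₂
  calc ‖f (x + s) - f x‖ ≤ c * |s| := by simpa using @hbound (x + s) (by simpa using hsε)
    _ ≤ (m + 1) * |s| := by gcongr; linarith

theorem PartiallyDifferentiableAt.exists_axisLipschitzAt {F : ℝ × ℝ → V} {p : ℝ × ℝ}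
    (h : PartiallyDifferentiableAt F p) :
    ∃ n : ℕ, AxisLipschitzAt (n + 1) (1 / ((n : ℝ) + 1)) F p := by
  obtain ⟨n₁, hn₁⟩ := exists_nat_forall_norm_sub_le h.1
  obtain ⟨n₂, hn₂⟩ := exists_nat_forall_norm_sub_le h.2
  exact ⟨max n₁ n₂, fun s hs => ⟨hn₁ _ (le_max_left _ _) s hs, hn₂ _ (le_max_right _ _) s hs⟩⟩

theorem exists_ball_axisLipschitzAt {F : ℝ × ℝ → V} (hF : Continuous F) {E : Set (ℝ × ℝ)}
    (hE : IsLocallyClosed E) (hne : E.Nonempty) (hdiff : ∀ p ∈ E, PartiallyDifferentiableAt F p) :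
    ∃ p₀ ∈ E, ∃ M > 0, ∃ κ > 0, ∀ p ∈ E ∩ Metric.ball p₀ κ, AxisLipschitzAt M κ F p := by
  have := hE.locallyCompactSpace
  have := hne.to_subtype
  let W : ℕ → Set E := fun n => {p | AxisLipschitzAt (n + 1) (1 / ((n : ℝ) + 1)) F p}
  have hW : ∀ n, IsClosed (W n) := fun n =>
    (isClosed_axisLipschitzAt hF _ _).preimage continuous_subtype_val
  have hcover : ⋃ n, W n = univ := eq_univ_of_forall fun p =>
    mem_iUnion.2 (hdiff p p.2).exists_axisLipschitzAt
  obtain ⟨n, p₀, hp₀⟩ := nonempty_interior_of_iUnion_of_closed hW hcover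
  obtain ⟨ε, hε, hball⟩ := Metric.mem_nhds_iff.1 (mem_interior_iff_mem_nhds.1 hp₀)
  refine ⟨p₀, p₀.2, n + 1, by positivity, min ε (1 / (n + 1)), by positivity, fun p hp => ?_⟩
  exact (@hball ⟨p, hp.1⟩ (Metric.mem_ball.2 (hp.2.trans_le (min_le_left _ _)))).mono le_rfl
    (min_le_right _ _)

theorem sides_le_of_subset_ball {a b c d r : ℝ} {p : ℝ × ℝ} (hab : a ≤ b) (hcd : c ≤ d)
    (h : Icc a b ×ˢ Icc c d ⊆ Metric.ball p r) : b - a ≤ 2 * r ∧ d - c ≤ 2 * r := by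
  have hlow : dist ((a, c) : ℝ × ℝ) p < r := h ⟨left_mem_Icc.2 hab, left_mem_Icc.2 hcd⟩
  have hupp : dist ((b, d) : ℝ × ℝ) p < r := h ⟨right_mem_Icc.2 hab, right_mem_Icc.2 hcd⟩
  have hdist : dist ((b, d) : ℝ × ℝ) (a, c) ≤ 2 * r := by
    linarith [dist_triangle_right ((b, d) : ℝ × ℝ) (a, c) p]
  rw [Prod.dist_eq, max_le_iff] at hdist
  exact ⟨(le_abs_self _).trans hdist.1, (le_abs_self _).trans hdist.2⟩

theorem subset_regularSet {P Q : ℝ × ℝ → ℝ} (hP : Continuous P) (hQ : Continuous Q)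
    {U : Set (ℝ × ℝ)} (hU : IsOpen U) (hdiffP : ∀ p ∈ U, PartiallyDifferentiableAt P p)
    (hdiffQ : ∀ p ∈ U, PartiallyDifferentiableAt Q p)
    (hPQ : ∀ p ∈ U, deriv (fun y => P (p.1, y)) p.2 = deriv (fun x => Q (x, p.2)) p.1) :
    U ⊆ regularSet P Q := by
  by_contra hUreg
  obtain ⟨p₀, ⟨hp₀U, hp₀⟩, M, hM, κ, hκ, hlip⟩ := exists_ball_axisLipschitzAt (hP.prodMk hQ)
    (hU.isLocallyClosed.inter (isOpen_regularSet P Q).isClosed_compl.isLocallyClosed)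
    (not_subset.1 hUreg)
    (fun p hp => ⟨(hdiffP p hp.1).1.prodMk (hdiffQ p hp.1).1,
      (hdiffP p hp.1).2.prodMk (hdiffQ p hp.1).2⟩)
  obtain ⟨r, hr, hrU⟩ := Metric.nhds_basis_closedBall.mem_iff.1 (hU.mem_nhds hp₀U)
  obtain ⟨δ, hδ, hδr, hδκ⟩ : ∃ δ > 0, δ ≤ r ∧ 2 * δ ≤ κ :=
    ⟨min r (κ / 2), by positivity, min_le_left _ _, by linarith [min_le_right r (κ / 2)]⟩
  set S := Metric.closedBall p₀ δ \ regularSet P Q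
  have hS : IsCompact S := (isCompact_closedBall p₀ δ).diff (isOpen_regularSet P Q)
  have hSU : ∀ p ∈ S, p ∈ U := fun p hp => hrU (Metric.closedBall_subset_closedBall hδr hp.1)
  have hSlip : ∀ p ∈ S, AxisLipschitzAt M κ (fun p => (P p, Q p)) p := fun p hp =>
    hlip p ⟨⟨hSU p hp, hp.2⟩, Metric.closedBall_subset_ball (by linarith) hp.1⟩
  refine hp₀ ⟨δ, hδ, fun a b c d hab hcd hball => ?_⟩
  obtain ⟨hba, hdc⟩ := sides_le_of_subset_ball hab hcd hball
  refine rectIntegral_eq_zero_of_axisLipschitzAt hP hQ hS hM.le hκ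
    (fun p hp s hs => ?_) (fun p hp s hs => ?_)
    (fun p hp => (hdiffP p (hSU p hp)).2) (fun p hp => (hdiffQ p (hSU p hp)).1)
    (fun p hp => hPQ p (hSU p hp)) hab hcd (hba.trans hδκ) (hdc.trans hδκ)
    (fun p hp => not_not.1 fun hreg => hp.2 ⟨Metric.ball_subset_closedBall (hball hp.1), hreg⟩)
  · exact (hSlip p hp s hs).imp (norm_fst_le _).trans (norm_fst_le _).trans
  · exact (hSlip p hp s hs).imp (norm_snd_le _).trans (norm_snd_le _).trans

theorem rectIntegral_eq_zero_of_continuous {P Q : ℝ × ℝ → ℝ} (hP : Continuous P)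
    (hQ : Continuous Q) {a b c d : ℝ} (hab : a ≤ b) (hcd : c ≤ d)
    (hdiffP : ∀ p ∈ Ioo a b ×ˢ Ioo c d, PartiallyDifferentiableAt P p)
    (hdiffQ : ∀ p ∈ Ioo a b ×ˢ Ioo c d, PartiallyDifferentiableAt Q p)
    (hPQ : ∀ p ∈ Ioo a b ×ˢ Ioo c d,
      deriv (fun y => P (p.1, y)) p.2 = deriv (fun x => Q (x, p.2)) p.1) :
    rectIntegral P Q a b c d = 0 :=
  rectIntegral_eq_zero_of_Ioo_subset_regularSet hP hQ hab hcd
    (subset_regularSet hP hQ (isOpen_Ioo.prod isOpen_Ioo) hdiffP hdiffQ hPQ)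

theorem PartiallyDifferentiableAt.congr {F G : ℝ × ℝ → V} {p : ℝ × ℝ}
    (hF : PartiallyDifferentiableAt F p) (hFG : F =ᶠ[𝓝 p] G) : PartiallyDifferentiableAt G p :=
  ⟨hF.1.congr_of_eventuallyEq (eventuallyEq_slices hFG.symm).1,
    hF.2.congr_of_eventuallyEq (eventuallyEq_slices hFG.symm).2⟩

theorem PartiallyDifferentiableAt.clm_comp {W : Type*} [NormedAddCommGroup W] [NormedSpace ℝ W]
    {F : ℝ × ℝ → V} {p : ℝ × ℝ} (hF : PartiallyDifferentiableAt F p) (L : V →L[ℝ] W) :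
    PartiallyDifferentiableAt (fun p => L (F p)) p :=
  ⟨L.differentiableAt.comp p.1 hF.1, L.differentiableAt.comp p.2 hF.2⟩

theorem looman_menchoff [CompleteSpace V] {P Q : ℝ × ℝ → V} {a b c d : ℝ} (hab : a ≤ b)
    (hcd : c ≤ d) (hP : ContinuousOn P (Icc a b ×ˢ Icc c d))
    (hQ : ContinuousOn Q (Icc a b ×ˢ Icc c d))
    (hdiffP : ∀ p ∈ Ioo a b ×ˢ Ioo c d, PartiallyDifferentiableAt P p)
    (hdiffQ : ∀ p ∈ Ioo a b ×ˢ Ioo c d, PartiallyDifferentiableAt Q p)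
    (hPQ : ∀ p ∈ Ioo a b ×ˢ Ioo c d,
      deriv (fun y => P (p.1, y)) p.2 = deriv (fun x => Q (x, p.2)) p.1) :
    rectIntegral P Q a b c d = 0 := by
  obtain ⟨P', hP', hPP'⟩ := exists_continuous_eqOn_rect hab hcd hP
  obtain ⟨Q', hQ', hQQ'⟩ := exists_continuous_eqOn_rect hab hcd hQ
  have hnhds : ∀ p ∈ Ioo a b ×ˢ Ioo c d, Icc a b ×ˢ Icc c d ∈ 𝓝 p := fun p hp =>
    prod_mem_nhds (Icc_mem_nhds hp.1.1 hp.1.2) (Icc_mem_nhds hp.2.1 hp.2.2)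
  have hPnhds : ∀ p ∈ Ioo a b ×ˢ Ioo c d, P =ᶠ[𝓝 p] P' := fun p hp =>
    eventually_of_mem (hnhds p hp) hPP'
  have hQnhds : ∀ p ∈ Ioo a b ×ˢ Ioo c d, Q =ᶠ[𝓝 p] Q' := fun p hp =>
    eventually_of_mem (hnhds p hp) hQQ'
  have hdiffP' : ∀ p ∈ Ioo a b ×ˢ Ioo c d, PartiallyDifferentiableAt P' p := fun p hp =>
    (hdiffP p hp).congr (hPnhds p hp)
  have hdiffQ' : ∀ p ∈ Ioo a b ×ˢ Ioo c d, PartiallyDifferentiableAt Q' p := fun p hp =>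
    (hdiffQ p hp).congr (hQnhds p hp)
  rw [rectIntegral_congr hab hcd hPP' hQQ']
  refine SeparatingDual.eq_zero_of_forall_dual_eq_zero (R := ℝ) fun L => ?_
  rw [← rectIntegral_clm_comp L hP' hQ']
  refine rectIntegral_eq_zero_of_continuous (by fun_prop) (by fun_prop) hab hcd
    (fun p hp => (hdiffP' p hp).clm_comp L) (fun p hp => (hdiffQ' p hp).clm_comp L) fun p hp => ?_
  have hP'Q' : deriv (fun y => P' (p.1, y)) p.2 = deriv (fun x => Q' (x, p.2)) p.1 := by
    rw [← (eventuallyEq_slices (hPnhds p hp)).2.deriv_eq, hPQ p hp,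
      (eventuallyEq_slices (hQnhds p hp)).1.deriv_eq]
  exact (L.hasFDerivAt.comp_hasDerivAt p.2 (hdiffP' p hp).2.hasDerivAt).deriv.trans
    ((congrArg L hP'Q').trans
      (L.hasFDerivAt.comp_hasDerivAt p.1 (hdiffQ' p hp).1.hasDerivAt).deriv.symm)

end Baire

/-! ### Integrals along segments -/

section SegmentIntegral

variable {E V : Type*} [NormedAddCommGroup E] [NormedSpace ℝ E] [NormedAddCommGroup V]
  [NormedSpace ℝ V]

/-- The integral of `Φ dζ` along the segment from `x` to `y`, where the product of a vector `h` and
a value `u` is `Λ h u`. -/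
noncomputable def segmentIntegral (Λ : E →L[ℝ] V →L[ℝ] V) (Φ : E → V) (x y : E) : V :=
  ∫ t in (0 : ℝ)..1, Λ (y - x) (Φ (x + t • (y - x)))

/-- `d` is the Gateaux derivative of `Φ` at `ζ`, taken one-sidedly, with respect to the
product `Λ`. -/
def HasGateauxDeriv (Λ : E →L[ℝ] V →L[ℝ] V) (Φ : E → V) (d : V) (ζ : E) : Prop :=
  ∀ h : E, Tendsto (fun ε : ℝ => ε⁻¹ • (Φ (ζ + ε • h) - Φ ζ)) (𝓝[>] 0) (𝓝 (Λ h d))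

/-- The affine parametrization, on the unit square, of the triangle `x y z` by the segments from `x`
to the points of the side `y z`. -/
noncomputable def coneMap (x y z : E) (p : ℝ × ℝ) : E := x + p.1 • (y - x + p.2 • (z - y))

/-- The first coefficient of the pull-back of the form `Φ dζ` by `coneMap x y z`. -/
noncomputable def coneFst (Λ : E →L[ℝ] V →L[ℝ] V) (Φ : E → V) (x y z : E) (p : ℝ × ℝ) : V :=
  Λ (y - x + p.2 • (z - y)) (Φ (coneMap x y z p))

/-- The second coefficient of the pull-back of the form `Φ dζ` by `coneMap x y z`. -/
noncomputable def coneSnd (Λ : E →L[ℝ] V →L[ℝ] V) (Φ : E → V) (x y z : E) (p : ℝ × ℝ) : V :=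
  p.1 • Λ (z - y) (Φ (coneMap x y z p))

variable {Λ : E →L[ℝ] V →L[ℝ] V} {Φ : E → V} {s : Set E} {x y z : E}

theorem HasGateauxDeriv.hasDerivAt_zero {d : V} {ζ : E} (hd : HasGateauxDeriv Λ Φ d ζ) (h : E) :
    HasDerivAt (fun t : ℝ => Φ (ζ + t • h)) (Λ h d) 0 := by
  rw [hasDerivAt_iff_tendsto_slope_zero, ← Iio_union_Ioi, nhdsWithin_union, tendsto_sup]
  simp only [zero_add, zero_smul, add_zero]
  refine ⟨?_, hd h⟩
  have hneg : Tendsto (fun ε : ℝ => -(ε⁻¹ • (Φ (ζ + ε • -h) - Φ ζ))) (𝓝[>] 0) (𝓝 (Λ h d)) := by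
    simpa using (hd (-h)).neg
  refine (hneg.comp (by simpa using tendsto_neg_nhdsLT (a := (0 : ℝ)))).congr fun t => ?_
  simp [inv_neg]

theorem HasGateauxDeriv.hasDerivAt {d : V} {t : ℝ} {h : E}
    (hd : HasGateauxDeriv Λ Φ d (x + t • h)) :
    HasDerivAt (fun t : ℝ => Φ (x + t • h)) (Λ h d) t := by
  have hshift : HasDerivAt (fun τ : ℝ => Φ (x + t • h + (τ - t) • h)) (Λ h d) t :=
    HasDerivAt.comp_sub_const t t (by simpa using hd.hasDerivAt_zero h)
  refine hshift.congr_of_eventuallyEq (Eventually.of_forall fun τ => congrArg Φ ?_)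
  module

theorem continuous_coneMap (x y z : E) : Continuous (coneMap x y z) := by
  unfold coneMap; fun_prop

theorem coneMap_mem (hs : Convex ℝ s) (hx : x ∈ s) (hy : y ∈ s) (hz : z ∈ s) {p : ℝ × ℝ}
    (hp : p ∈ Icc (0 : ℝ) 1 ×ˢ Icc (0 : ℝ) 1) : coneMap x y z p ∈ s := by
  have hq : y + p.2 • (z - y) ∈ s := hs.add_smul_sub_mem hy hz hp.2
  convert hs.add_smul_sub_mem hx hq hp.1 using 1
  unfold coneMap; module

theorem coneMap_eq (x y z : E) (p : ℝ × ℝ) :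
    coneMap x y z p = x + p.1 • (y - x) + p.2 • p.1 • (z - y) := by
  unfold coneMap; module

theorem hasDerivAt_comp_coneMap {d : V} {p : ℝ × ℝ}
    (hd : HasGateauxDeriv Λ Φ d (coneMap x y z p)) :
    HasDerivAt (fun s => Φ (coneMap x y z (s, p.2))) (Λ (y - x + p.2 • (z - y)) d) p.1 ∧
      HasDerivAt (fun t => Φ (coneMap x y z (p.1, t))) (Λ (p.1 • (z - y)) d) p.2 := by
  refine ⟨HasGateauxDeriv.hasDerivAt hd, ?_⟩
  rw [coneMap_eq] at hd
  simpa only [coneMap_eq] using hd.hasDerivAt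

theorem hasDerivAt_coneFst {d : V} {p : ℝ × ℝ} (hd : HasGateauxDeriv Λ Φ d (coneMap x y z p)) :
    HasDerivAt (fun t => coneFst Λ Φ x y z (p.1, t)) (Λ (z - y) (Φ (coneMap x y z p)) +
      Λ (y - x + p.2 • (z - y)) (Λ (p.1 • (z - y)) d)) p.2 := by
  have hline : HasDerivAt (fun t : ℝ => y - x + t • (z - y)) (z - y) p.2 := by
    simpa using ((hasDerivAt_id p.2).smul_const (z - y)).const_add (y - x)
  exact (Λ.hasFDerivAt.comp_hasDerivAt p.2 hline).clm_apply (hasDerivAt_comp_coneMap hd).2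

theorem hasDerivAt_coneSnd {d : V} {p : ℝ × ℝ} (hd : HasGateauxDeriv Λ Φ d (coneMap x y z p)) :
    HasDerivAt (fun s => coneSnd Λ Φ x y z (s, p.2)) (Λ (z - y) (Φ (coneMap x y z p)) +
      p.1 • Λ (z - y) (Λ (y - x + p.2 • (z - y)) d)) p.1 := by
  have hcone := (Λ (z - y)).hasFDerivAt.comp_hasDerivAt p.1 (hasDerivAt_comp_coneMap hd).1
  have hsmul := (hasDerivAt_id p.1).smul hcone
  rwa [one_smul, add_comm] at hsmul

theorem partiallyDifferentiableAt_coneFst {d : V} {p : ℝ × ℝ}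
    (hd : HasGateauxDeriv Λ Φ d (coneMap x y z p)) :
    PartiallyDifferentiableAt (coneFst Λ Φ x y z) p :=
  ⟨(Λ (y - x + p.2 • (z - y))).differentiableAt.comp p.1
    (hasDerivAt_comp_coneMap hd).1.differentiableAt, (hasDerivAt_coneFst hd).differentiableAt⟩

theorem partiallyDifferentiableAt_coneSnd {d : V} {p : ℝ × ℝ}
    (hd : HasGateauxDeriv Λ Φ d (coneMap x y z p)) :
    PartiallyDifferentiableAt (coneSnd Λ Φ x y z) p :=
  ⟨(hasDerivAt_coneSnd hd).differentiableAt, ((Λ (z - y)).differentiableAt.comp p.2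
    (hasDerivAt_comp_coneMap hd).2.differentiableAt).const_smul p.1⟩

theorem intervalIntegrable_segment (Λ : E →L[ℝ] V →L[ℝ] V)
    (hΦ : ContinuousOn (fun t : ℝ => Φ (x + t • (y - x))) (Icc 0 1)) :
    IntervalIntegrable (fun t : ℝ => Λ (y - x) (Φ (x + t • (y - x)))) MeasureTheory.volume 0 1 := by
  refine ContinuousOn.intervalIntegrable ?_
  rw [uIcc_of_le zero_le_one]
  exact (Λ (y - x)).continuous.comp_continuousOn hΦ

theorem rectIntegral_cone (hs : Convex ℝ s) (hΦ : ContinuousOn Φ s) (hx : x ∈ s) (hy : y ∈ s)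
    (hz : z ∈ s) : rectIntegral (coneFst Λ Φ x y z) (coneSnd Λ Φ x y z) 0 1 0 1 =
      segmentIntegral Λ Φ x y - segmentIntegral Λ Φ x z + segmentIntegral Λ Φ y z := by
  have hcont : ∀ w ∈ s, ContinuousOn (fun t : ℝ => Φ (x + t • (w - x))) (Icc 0 1) := fun w hw =>
    hΦ.comp (by fun_prop) fun t ht => hs.add_smul_sub_mem hx hw ht
  simp only [segmentIntegral]
  rw [← intervalIntegral.integral_sub (intervalIntegrable_segment Λ (hcont y hy))
    (intervalIntegrable_segment Λ (hcont z hz))]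
  simp [rectIntegral, coneFst, coneSnd, coneMap, ← add_assoc]

theorem segmentIntegral_add_of_convex [CompleteSpace V]
    (hΛ : ∀ h h' u, Λ h (Λ h' u) = Λ h' (Λ h u)) (hs : Convex ℝ s) (hΦ : ContinuousOn Φ s)
    (hder : ∀ x ∈ s, ∃ d, HasGateauxDeriv Λ Φ d x) (hx : x ∈ s) (hy : y ∈ s) (hz : z ∈ s) :
    segmentIntegral Λ Φ x y + segmentIntegral Λ Φ y z = segmentIntegral Λ Φ x z := by
  have hd : ∀ p ∈ Ioo (0 : ℝ) 1 ×ˢ Ioo (0 : ℝ) 1, ∃ d, HasGateauxDeriv Λ Φ d (coneMap x y z p) :=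
    fun p hp => hder _ (coneMap_mem hs hx hy hz
      (Set.prod_mono Ioo_subset_Icc_self Ioo_subset_Icc_self hp))
  have hcone : ContinuousOn (fun p => Φ (coneMap x y z p)) (Icc (0 : ℝ) 1 ×ˢ Icc (0 : ℝ) 1) :=
    hΦ.comp (continuous_coneMap x y z).continuousOn fun _ hp => coneMap_mem hs hx hy hz hp
  have hzero : rectIntegral (coneFst Λ Φ x y z) (coneSnd Λ Φ x y z) 0 1 0 1 = 0 := by
    refine looman_menchoff zero_le_one zero_le_one (ContinuousOn.clm_apply (by fun_prop) hcone)
      (continuousOn_fst.smul (ContinuousOn.clm_apply (by fun_prop) hcone)) (fun p hp => ?_)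
      (fun p hp => ?_) (fun p hp => ?_) <;> obtain ⟨d, hd⟩ := hd p hp
    · exact partiallyDifferentiableAt_coneFst hd
    · exact partiallyDifferentiableAt_coneSnd hd
    · rw [(hasDerivAt_coneFst hd).deriv, (hasDerivAt_coneSnd hd).deriv, hΛ, map_smul,
        smul_apply]
  rw [rectIntegral_cone hs hΦ hx hy hz, sub_add_eq_add_sub, sub_eq_zero] at hzero
  exact hzero

theorem norm_segmentIntegral_sub_le [CompleteSpace V] {u : V} {ε : ℝ}
    (hcont : ContinuousOn (fun t : ℝ => Φ (x + t • (y - x))) (Icc 0 1))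
    (hε : ∀ t ∈ Icc (0 : ℝ) 1, ‖Φ (x + t • (y - x)) - u‖ ≤ ε) :
    ‖segmentIntegral Λ Φ x y - Λ (y - x) u‖ ≤ ‖Λ‖ * ‖y - x‖ * ε := by
  have hdiff : segmentIntegral Λ Φ x y - Λ (y - x) u =
      ∫ t in (0 : ℝ)..1, Λ (y - x) (Φ (x + t • (y - x)) - u) := by
    simp only [map_sub (Λ (y - x))]
    rw [intervalIntegral.integral_sub (intervalIntegrable_segment Λ hcont) intervalIntegrable_const,
      segmentIntegral, intervalIntegral.integral_const, sub_zero, one_smul]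
  have hbound : ∀ t ∈ uIoc (0 : ℝ) 1,
      ‖Λ (y - x) (Φ (x + t • (y - x)) - u)‖ ≤ ‖Λ‖ * ‖y - x‖ * ε := fun t ht =>
    (Λ.le_opNorm₂ _ _).trans (mul_le_mul_of_nonneg_left
      (hε t (Ioc_subset_Icc_self (by rwa [uIoc_of_le zero_le_one] at ht))) (by positivity))
  rw [hdiff]
  simpa using intervalIntegral.norm_integral_le_of_norm_le_const hbound

end SegmentIntegral

/-! ### Local cocycles and their primitives -/

section LocalCocycle

variable {V : Type*} [NormedAddCommGroup V]

/-- `j` is additive on the triples of points of `X` whose mutual distances are less than `η`. -/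
def IsLocalCocycle {W : Type*} [PseudoMetricSpace W] (j : W → W → V) (X : Set W) (η : ℝ) : Prop :=
  ∀ x ∈ X, ∀ y ∈ X, ∀ z ∈ X, dist x y < η → dist y z < η → dist x z < η → j x y + j y z = j x z

/-- `G` is a primitive of `j` on `X` at scale `η`: its increment between points of `X` at distance
less than `η` is `j`. -/
def IsPrimitiveAt {W : Type*} [PseudoMetricSpace W] (j : W → W → V) (X : Set W) (η : ℝ)
    (G : W → V) : Prop :=
  ∀ x ∈ X, ∀ y ∈ X, dist x y < η → G y - G x = j x y

section PseudoMetric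

variable {W : Type*} [PseudoMetricSpace W] {j : W → W → V} {X Y : Set W} {η θ : ℝ} {G : W → V}

theorem IsLocalCocycle.mono (h : IsLocalCocycle j X η) (hY : Y ⊆ X) : IsLocalCocycle j Y η :=
  fun x hx y hy z hz => h x (hY hx) y (hY hy) z (hY hz)

theorem IsLocalCocycle.exists_comp {T : Type*} [PseudoMetricSpace T] {c : T → W} {s : Set T}
    (h : IsLocalCocycle j X η) (hη : 0 < η) (hc : UniformContinuousOn c s) (hX : MapsTo c s X) :
    ∃ θ > 0, IsLocalCocycle (fun t t' => j (c t) (c t')) s θ := by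
  obtain ⟨θ, hθ, hcθ⟩ := Metric.uniformContinuousOn_iff.1 hc η hη
  exact ⟨θ, hθ, fun x hx y hy z hz hxy hyz hxz => h _ (hX hx) _ (hX hy) _ (hX hz)
    (hcθ x hx y hy hxy) (hcθ y hy z hz hyz) (hcθ x hx z hz hxz)⟩

theorem IsLocalCocycle.self_eq_zero (h : IsLocalCocycle j X η) (hη : 0 < η) {x : W} (hx : x ∈ X) :
    j x x = 0 := by
  have hd : dist x x < η := by rwa [dist_self]
  exact add_eq_left.1 (h x hx x hx x hx hd hd hd)

-- Both sums along the two broken lines from `x` to `y'` equal the value on the diagonal.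
theorem IsLocalCocycle.sub_eq_sub (h : IsLocalCocycle j X η) {x x' y y' : W} (hx : x ∈ X)
    (hx' : x' ∈ X) (hy : y ∈ X) (hy' : y' ∈ X) (hxx : dist x x' < η / 2) (hyy : dist y y' < η / 2)
    (hxy : dist x y < η / 2) (hxy' : dist x' y' < η / 2) :
    j y y' - j x x' = j x' y' - j x y := by
  have hη : 0 < η := by linarith [dist_nonneg.trans_lt hxx]
  have hdiag : dist x y' < η := (dist_triangle x x' y').trans_lt (by linarith)
  rw [sub_eq_sub_iff_add_eq_add, add_comm,
    h x hx y hy y' hy' (by linarith) (by linarith) hdiag, add_comm (j x' y'),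
    h x hx x' hx' y' hy' (by linarith) (by linarith) hdiag]

theorem IsPrimitiveAt.mono (h : IsPrimitiveAt j X η G) (hY : Y ⊆ X) (hθ : θ ≤ η) :
    IsPrimitiveAt j Y θ G :=
  fun x hx y hy hxy => h x (hY hx) y (hY hy) (hxy.trans_le hθ)

theorem IsPrimitiveAt.sub_eq_sub_of_isPreconnected {T : Type*} [PseudoMetricSpace T] {c : T → W}
    {s : Set T} {g : T → V} (hG : IsPrimitiveAt j X η G) (hη : 0 < η)
    (hg : IsPrimitiveAt (fun t t' => j (c t) (c t')) s η g) (hs : IsPreconnected s)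
    (hc : ContinuousOn c s) (hX : MapsTo c s X) {t t' : T} (ht : t ∈ s) (ht' : t' ∈ s) :
    G (c t') - G (c t) = g t' - g t := by
  refine hs.induction₂ (fun t t' => G (c t') - G (c t) = g t' - g t) (fun t ht => ?_)
    (fun t t' t'' _ _ _ h h' => ?_) (fun t t' _ _ h => ?_) ht ht'
  · have hnear : ∀ᶠ t' in 𝓝[s] t, dist t t' < η ∧ dist (c t) (c t') < η := by
      simp only [dist_comm t, dist_comm (c t)]
      exact (eventually_nhdsWithin_of_eventually_nhds (Metric.ball_mem_nhds t hη)).and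
        ((hc t ht).eventually_mem (Metric.ball_mem_nhds _ hη))
    filter_upwards [hnear, self_mem_nhdsWithin] with t' ⟨hd, hcd⟩ ht'
    rw [hG _ (hX ht) _ (hX ht') hcd, hg _ ht _ ht' hd]
  · rw [← sub_add_sub_cancel (g t'') (g t'), ← h, ← h', sub_add_sub_cancel]
  · rw [← neg_sub, h, neg_sub]

end PseudoMetric

section Chain

variable {W : Type*} [NormedAddCommGroup W] [NormedSpace ℝ W] {j : W → W → V} {X : Set W} {η : ℝ}

/-- The sum of `j` over the `m` equal parts of the segment from `x` to `y`. -/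
noncomputable def chainSum (j : W → W → V) (m : ℕ) (x y : W) : V :=
  ∑ i ∈ Finset.range m,
    j (AffineMap.lineMap x y ((i : ℝ) / m)) (AffineMap.lineMap x y (((i + 1 : ℕ) : ℝ) / m))

theorem div_mem_Icc_of_le {i m : ℕ} (h : i ≤ m) : (i : ℝ) / m ∈ Icc (0 : ℝ) 1 :=
  ⟨by positivity, div_le_one_of_le₀ (by exact_mod_cast h) (by positivity)⟩

theorem exists_nat_pos_div_lt (D : ℝ) {η : ℝ} (hη : 0 < η) : ∃ m : ℕ, 0 < m ∧ D / m < η := by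
  have hlim : ∀ᶠ m : ℕ in atTop, D / m < η :=
    (tendsto_const_div_atTop_nhds_zero_nat D).eventually (gt_mem_nhds hη)
  exact ((eventually_gt_atTop 0).and hlim).exists

theorem dist_lineMap_div (x y : W) (i : ℕ) {m : ℕ} (hm : 0 < m) :
    dist (AffineMap.lineMap x y ((i : ℝ) / m)) (AffineMap.lineMap x y (((i + 1 : ℕ) : ℝ) / m)) =
      dist x y / m := by
  have hdiff : ((i + 1 : ℕ) : ℝ) / m - (i : ℝ) / m = (m : ℝ)⁻¹ := by
    rw [← sub_div, Nat.cast_succ, add_sub_cancel_left, one_div]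
  rw [dist_lineMap_lineMap, dist_comm, Real.dist_eq, hdiff, abs_of_nonneg (by positivity),
    inv_mul_eq_div]

theorem dist_lineMap_le (o x y : W) {t : ℝ} (ht : t ∈ Icc (0 : ℝ) 1) :
    dist (AffineMap.lineMap o x t) (AffineMap.lineMap o y t) ≤ dist x y := by
  have hsub : AffineMap.lineMap o x t - AffineMap.lineMap o y t = t • (x - y) := by
    simp only [AffineMap.lineMap_apply_module]; module
  rw [dist_eq_norm, hsub, norm_smul, Real.norm_of_nonneg ht.1, dist_eq_norm]
  exact mul_le_of_le_one_left (norm_nonneg _) ht.2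

theorem IsPrimitiveAt.chainSum_eq {G : W → V} (h : IsPrimitiveAt j X η G) {x y : W}
    (hX : segment ℝ x y ⊆ X) {m : ℕ} (hm : 0 < m) (hd : dist x y / m < η) :
    chainSum j m x y = G y - G x := by
  have hmem : ∀ i ≤ m, AffineMap.lineMap x y ((i : ℝ) / m) ∈ X := fun i hi =>
    hX ((convex_segment x y).lineMap_mem (left_mem_segment ℝ x y) (right_mem_segment ℝ x y)
      (div_mem_Icc_of_le hi))
  have hterm : ∀ i ∈ Finset.range m,
      j (AffineMap.lineMap x y ((i : ℝ) / m)) (AffineMap.lineMap x y (((i + 1 : ℕ) : ℝ) / m)) =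
        G (AffineMap.lineMap x y (((i + 1 : ℕ) : ℝ) / m)) -
          G (AffineMap.lineMap x y ((i : ℝ) / m)) := fun i hi =>
    (h _ (hmem i (Finset.mem_range.1 hi).le) _ (hmem (i + 1) (Finset.mem_range.1 hi))
      (by rwa [dist_lineMap_div x y i hm])).symm
  rw [chainSum, Finset.sum_congr rfl hterm,
    Finset.sum_range_sub (fun i : ℕ => G (AffineMap.lineMap x y ((i : ℝ) / m)))]
  simp [hm.ne']

-- The primitive at `x` is the sum along the segment from a fixed point `o`; the differences of the
-- sums to `x` and to `y` telescope along the ladder between the two segments.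
theorem IsLocalCocycle.exists_primitive (h : IsLocalCocycle j X η) (hη : 0 < η)
    (hX : Convex ℝ X) (hb : Bornology.IsBounded X) : ∃ G : W → V, IsPrimitiveAt j X (η / 2) G := by
  rcases X.eq_empty_or_nonempty with rfl | ⟨o, ho⟩
  · exact ⟨fun _ => 0, fun x hx => hx.elim⟩
  obtain ⟨C, hC⟩ := Metric.isBounded_iff.1 hb
  obtain ⟨m, hm, hmη⟩ := exists_nat_pos_div_lt C (half_pos hη)
  refine ⟨chainSum j m o, fun x hx y hy hxy => ?_⟩
  have hmem : ∀ z ∈ X, ∀ i ≤ m, AffineMap.lineMap o z ((i : ℝ) / m) ∈ X := fun z hz i hi =>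
    hX.lineMap_mem ho hz (div_mem_Icc_of_le hi)
  have hstep : ∀ z ∈ X, ∀ i : ℕ, dist (AffineMap.lineMap o z ((i : ℝ) / m))
      (AffineMap.lineMap o z (((i + 1 : ℕ) : ℝ) / m)) < η / 2 := fun z hz i => by
    rw [dist_lineMap_div o z i hm]
    exact (div_le_div_of_nonneg_right (hC ho hz) m.cast_nonneg).trans_lt hmη
  have hrung : ∀ i ≤ m, dist (AffineMap.lineMap o x ((i : ℝ) / m))
      (AffineMap.lineMap o y ((i : ℝ) / m)) < η / 2 := fun i hi =>
    (dist_lineMap_le o x y (div_mem_Icc_of_le hi)).trans_lt hxy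
  simp only [chainSum]
  rw [← Finset.sum_sub_distrib, Finset.sum_congr rfl fun i hi =>
      have hi : i < m := Finset.mem_range.1 hi
      h.sub_eq_sub (hmem x hx i hi.le) (hmem x hx _ hi) (hmem y hy i hi.le) (hmem y hy _ hi)
        (hstep x hx i) (hstep y hy i) (hrung i hi.le) (hrung _ hi),
    Finset.sum_range_sub (fun i : ℕ =>
      j (AffineMap.lineMap o x ((i : ℝ) / m)) (AffineMap.lineMap o y ((i : ℝ) / m)))]
  simp [hm.ne', h.self_eq_zero hη ho]

end Chain

end LocalCocycle

/-! ### Triangulated surfaces and their boundaries -/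

section Boundary

theorem isCompact_segment {W : Type*} [NormedAddCommGroup W] [NormedSpace ℝ W] (x y : W) :
    IsCompact (segment ℝ x y) := by
  rw [segment_eq_image_lineMap]
  exact isCompact_Icc.image AffineMap.lineMap_continuous

/-- The set of the three directed sides of an oriented triangle. -/
def triangleSides {α : Type*} [DecidableEq α] (s : α × α × α) : Finset (α × α) :=
  {(s.1, s.2.1), (s.2.1, s.2.2), (s.2.2, s.1)}

theorem mem_triangleSides {α : Type*} [DecidableEq α] {s : α × α × α} {u v : α} :
    (u, v) ∈ triangleSides s ↔ IsSideOf u v s := by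
  obtain ⟨a, b, c⟩ := s
  simp [triangleSides, IsSideOf]

variable {N : ℕ} {K : TriangulatedSurface N} {V : Type*} [AddCommGroup V] {u v : Fin N}

theorem IsSideOf.ne {s : Fin N × Fin N × Fin N} (h : IsSideOf u v s) (hs : s ∈ K.tri) : u ≠ v := by
  obtain ⟨h1, h2, h3⟩ := K.nondegenerate s hs
  rcases h with ⟨rfl, rfl⟩ | ⟨rfl, rfl⟩ | ⟨rfl, rfl⟩
  exacts [h1, h2, h3.symm]

namespace TriangulatedSurface

theorem IsBoundaryEdge.ne (h : K.IsBoundaryEdge u v) : u ≠ v := by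
  obtain ⟨⟨s, hs, hside⟩, -⟩ := h
  exact hside.ne hs

open scoped Classical in
/-- The set of the boundary edges, directed as sides of the triangles. -/
noncomputable def boundaryEdges (K : TriangulatedSurface N) : Finset (Fin N × Fin N) :=
  Finset.univ.filter fun p => K.IsBoundaryEdge p.1 p.2

theorem mem_boundaryEdges {p : Fin N × Fin N} :
    p ∈ K.boundaryEdges ↔ K.IsBoundaryEdge p.1 p.2 := by
  simp [boundaryEdges]

theorem sum_triangleSides {s : Fin N × Fin N × Fin N} (hs : s ∈ K.tri) (I : Fin N → Fin N → V) :
    ∑ p ∈ triangleSides s, I p.1 p.2 = I s.1 s.2.1 + I s.2.1 s.2.2 + I s.2.2 s.1 := by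
  obtain ⟨a, b, c⟩ := s
  obtain ⟨hab, -, hac⟩ := K.nondegenerate _ hs
  rw [triangleSides, Finset.sum_insert, Finset.sum_insert, Finset.sum_singleton, add_assoc]
  · simpa using fun _ => hac.symm
  · simpa using ⟨fun h => (hab h).elim, fun h => (hac h).elim⟩

theorem mem_biUnion_triangleSides_sdiff_boundaryEdges {p : Fin N × Fin N} :
    p ∈ K.tri.biUnion triangleSides \ K.boundaryEdges ↔
      (∃ s ∈ K.tri, IsSideOf p.1 p.2 s) ∧ ∃ s ∈ K.tri, IsSideOf p.2 p.1 s := by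
  obtain ⟨u, v⟩ := p
  simp only [Finset.mem_sdiff, mem_boundaryEdges, Finset.mem_biUnion, mem_triangleSides,
    IsBoundaryEdge]
  grind

theorem sum_boundaryEdges {I : Fin N → Fin N → V}
    (hI : ∀ s ∈ K.tri, ∀ u v, IsSideOf u v s → I v u = -I u v) :
    ∑ p ∈ K.boundaryEdges, I p.1 p.2 =
      ∑ s ∈ K.tri, (I s.1 s.2.1 + I s.2.1 s.2.2 + I s.2.2 s.1) := by
  have hdisj : (K.tri : Set (Fin N × Fin N × Fin N)).PairwiseDisjoint triangleSides :=
    fun s hs t ht hst => Finset.disjoint_left.2 fun p hp hp' =>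
      hst (K.oriented s hs t ht p.1 p.2 (mem_triangleSides.1 hp) (mem_triangleSides.1 hp'))
  have hsub : K.boundaryEdges ⊆ K.tri.biUnion triangleSides := fun p hp => by
    obtain ⟨⟨s, hs, hside⟩, -⟩ := mem_boundaryEdges.1 hp
    exact Finset.mem_biUnion.2 ⟨s, hs, mem_triangleSides.2 hside⟩
  have hinterior : ∑ p ∈ K.tri.biUnion triangleSides \ K.boundaryEdges, I p.1 p.2 = 0 := by
    refine Finset.sum_involution (fun p _ => p.swap) (fun p hp => ?_) (fun p hp _ heq => ?_)
      (fun p hp => ?_) (fun p _ => p.swap_swap) <;>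
      have hp := mem_biUnion_triangleSides_sdiff_boundaryEdges.1 hp
    · obtain ⟨⟨s, hs, hside⟩, -⟩ := hp
      simp [hI s hs _ _ hside]
    · obtain ⟨⟨s, hs, hside⟩, -⟩ := hp
      exact hside.ne hs (congrArg Prod.snd heq)
    · exact mem_biUnion_triangleSides_sdiff_boundaryEdges.2 hp.symm
  rw [← Finset.sum_congr rfl fun s hs => sum_triangleSides hs I, ← Finset.sum_biUnion hdisj,
    ← Finset.sum_sdiff hsub, hinterior, zero_add]

theorem sum_boundaryEdges_sub (K : TriangulatedSurface N) (φ : Fin N → V) :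
    ∑ p ∈ K.boundaryEdges, (φ p.2 - φ p.1) = 0 := by
  rw [sum_boundaryEdges (I := fun u v => φ v - φ u) fun _ _ _ _ _ => (neg_sub _ _).symm]
  exact Finset.sum_eq_zero fun s _ => by abel

theorem eq_sub_of_sum_boundaryEdges_eq_zero {I : Fin N → Fin N → V}
    (hI : ∑ p ∈ K.boundaryEdges, I p.1 p.2 = 0) (φ : Fin N → V) (huv : K.IsBoundaryEdge u v)
    (h : ∀ p ∈ K.boundaryEdges, p ≠ (u, v) → I p.1 p.2 = φ p.2 - φ p.1) :
    I u v = φ v - φ u := by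
  have hsum := Finset.sum_eq_single_of_mem (u, v) (mem_boundaryEdges.2 huv) fun p hp hne =>
    sub_eq_zero.2 (h p hp hne)
  rw [Finset.sum_sub_distrib, hI, K.sum_boundaryEdges_sub φ, sub_zero] at hsum
  exact sub_eq_zero.1 hsum.symm

-- Otherwise the boundary `v - u` of the single edge would vanish.
theorem IsBoundaryEdge.exists_ne (h : K.IsBoundaryEdge u v) :
    ∃ p ∈ K.boundaryEdges, p ≠ (u, v) := by
  by_contra! hall
  have hzero : (0 : ℤ) = Pi.single (M := fun _ => ℤ) v 1 v - Pi.single (M := fun _ => ℤ) v 1 u :=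
    eq_sub_of_sum_boundaryEdges_eq_zero (I := fun _ _ => 0) Finset.sum_const_zero _ h
      fun p hp hne => (hne (hall p hp)).elim
  simp [h.ne] at hzero

theorem isCompact_carrier (K : TriangulatedSurface N) : IsCompact K.carrier :=
  K.tri.isCompact_biUnion fun _ _ => (Set.toFinite _).isCompact_convexHull ℝ

theorem convexHull_subset_carrier {s : Fin N × Fin N × Fin N} (hs : s ∈ K.tri) :
    convexHull ℝ {vertex s.1, vertex s.2.1, vertex s.2.2} ⊆ K.carrier :=
  Set.subset_biUnion_of_mem (u := fun s : Fin N × Fin N × Fin N =>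
    convexHull ℝ {vertex s.1, vertex s.2.1, vertex s.2.2}) hs

theorem segment_subset_convexHull {s : Fin N × Fin N × Fin N} (h : IsSideOf u v s) :
    segment ℝ (vertex u) (vertex v) ⊆ convexHull ℝ {vertex s.1, vertex s.2.1, vertex s.2.2} := by
  rw [← convexHull_pair]
  refine convexHull_mono (pair_subset ?_ ?_) <;>
    rcases h with ⟨rfl, rfl⟩ | ⟨rfl, rfl⟩ | ⟨rfl, rfl⟩ <;> simp

theorem IsBoundaryEdge.segment_subset (h : K.IsBoundaryEdge u v) :
    segment ℝ (vertex u) (vertex v) ⊆ K.boundary := fun _ hx => ⟨u, v, h, hx⟩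

theorem boundary_subset_carrier (K : TriangulatedSurface N) : K.boundary ⊆ K.carrier := by
  rintro x ⟨u, v, ⟨⟨s, hs, hside⟩, -⟩, hx⟩
  exact convexHull_subset_carrier hs (segment_subset_convexHull hside hx)

theorem isCompact_boundary (K : TriangulatedSurface N) : IsCompact K.boundary := by
  have hunion : K.boundary = ⋃ p ∈ K.boundaryEdges, segment ℝ (vertex p.1) (vertex p.2) := by
    ext x
    simp only [boundary, mem_ofPred_eq, mem_iUnion, mem_boundaryEdges, exists_prop, Prod.exists]
  rw [hunion]
  exact K.boundaryEdges.isCompact_biUnion fun p _ => isCompact_segment _ _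

theorem lineMap_vertex_apply_snd (h : u ≠ v) (s : ℝ) :
    (AffineMap.lineMap (vertex u) (vertex v) s : Fin N → ℝ) v = s := by
  simp [AffineMap.lineMap_apply_module, vertex, h.symm]

theorem eq_lineMap_of_mem_segment (h : u ≠ v) {x : Fin N → ℝ}
    (hx : x ∈ segment ℝ (vertex u) (vertex v)) :
    x = AffineMap.lineMap (vertex u) (vertex v) (x v) := by
  rw [segment_eq_image_lineMap] at hx
  obtain ⟨s, -, rfl⟩ := hx
  rw [lineMap_vertex_apply_snd h]

theorem eq_or_eq_of_mem_segment {w : Fin N} {x : Fin N → ℝ}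
    (hx : x ∈ segment ℝ (vertex u) (vertex v)) (hw : x w ≠ 0) : w = u ∨ w = v := by
  by_contra! hcon
  rw [segment_eq_image_lineMap] at hx
  obtain ⟨s, -, rfl⟩ := hx
  exact hw (by simp [AffineMap.lineMap_apply_module, vertex, hcon.1, hcon.2])

theorem IsBoundaryEdge.midpoint_notMem_segment (h : K.IsBoundaryEdge u v) {p : Fin N × Fin N}
    (hp : K.IsBoundaryEdge p.1 p.2) (hne : p ≠ (u, v)) :
    midpoint ℝ (vertex u) (vertex v) ∉ segment ℝ (vertex p.1) (vertex p.2) := by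
  intro hmem
  have hu := eq_or_eq_of_mem_segment hmem (w := u) (by simp [midpoint_eq_smul_add, vertex, h.ne])
  have hv := eq_or_eq_of_mem_segment hmem (w := v)
    (by simp [midpoint_eq_smul_add, vertex, h.ne.symm])
  obtain ⟨p₁, p₂⟩ := p
  obtain ⟨⟨s, hs, hside⟩, -⟩ := hp
  rcases hu with rfl | rfl <;> rcases hv with rfl | rfl
  · exact h.ne rfl
  · exact hne rfl
  · exact h.2 s hs hside
  · exact h.ne rfl

end TriangulatedSurface

end Boundary

/-! ### Simple loops along the boundary -/

section Loop

theorem isPreconnected_inter_preimage {X Y : Type*} [TopologicalSpace X] [TopologicalSpace Y]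
    [T2Space Y] {c : X → Y} {k : Set X} {s : Set Y} (hk : IsCompact k) (hc : ContinuousOn c k)
    (hinj : InjOn c k) (hs : IsPreconnected s) (hsk : s ⊆ c '' k) :
    IsPreconnected (k ∩ c ⁻¹' s) := by
  have : CompactSpace k := isCompact_iff_compactSpace.1 hk
  have hemb : IsClosedEmbedding (k.domRestrict c) :=
    hc.domRestrict.isClosedEmbedding (injOn_iff_injective.1 hinj)
  have hpre : IsPreconnected (k.domRestrict c ⁻¹' s) :=
    hs.preimage_of_isClosedMap hemb.injective hemb.isClosedMap (by rwa [range_domRestrict])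
  rw [← Subtype.image_preimage_coe]
  exact hpre.image _ continuous_subtype_val.continuousOn

/-- A Jordan curve in `X`, given as a continuous `1`-periodic map that is injective modulo `1`. -/
structure IsSimpleLoop {X : Type*} [TopologicalSpace X] (c : ℝ → X) : Prop where
  continuous : Continuous c
  periodic : Function.Periodic c 1
  exists_sub_eq_intCast : ∀ t t', c t = c t' → ∃ n : ℤ, t - t' = n

namespace IsSimpleLoop

variable {X : Type*} [TopologicalSpace X] {c : ℝ → X}

theorem eq_of_abs_sub_lt_one (hc : IsSimpleLoop c) {t t' : ℝ} (h : c t = c t')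
    (hlt : |t - t'| < 1) : t = t' := by
  obtain ⟨n, hn⟩ := hc.exists_sub_eq_intCast t t' h
  have hn0 : n = 0 := Int.abs_lt_one_iff.1 (by rw [hn] at hlt; exact_mod_cast hlt)
  rw [hn0, Int.cast_zero] at hn
  exact sub_eq_zero.1 hn

theorem injOn_Ico (hc : IsSimpleLoop c) (q : ℝ) : InjOn c (Ico q (q + 1)) := fun t ht t' ht' h =>
  hc.eq_of_abs_sub_lt_one h (abs_lt.2 ⟨by linarith [ht.1, ht'.2], by linarith [ht.2, ht'.1]⟩)

theorem exists_mem_Ico (hc : IsSimpleLoop c) {x : X} (hx : x ∈ range c) (q : ℝ) :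
    ∃ t ∈ Ico q (q + 1), c t = x := by
  obtain ⟨t, rfl⟩ := hx
  obtain ⟨t', ht', h⟩ := hc.periodic.exists_mem_Ico one_pos t q
  exact ⟨t', ht', h.symm⟩

theorem mem_Ioo_of_ne (hc : IsSimpleLoop c) {q t : ℝ} (ht : t ∈ Icc q (q + 1)) (h : c t ≠ c q) :
    t ∈ Ioo q (q + 1) := by
  refine ⟨lt_of_le_of_ne ht.1 ?_, lt_of_le_of_ne ht.2 ?_⟩
  · rintro rfl; exact h rfl
  · rintro rfl; exact h (hc.periodic q)

theorem isPreconnected_preimage [T2Space X] (hc : IsSimpleLoop c) {s : Set X}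
    (hs : IsPreconnected s) (hclosed : IsClosed s) (hsub : s ⊆ range c) {q : ℝ} (hq : c q ∉ s) :
    IsPreconnected (Icc q (q + 1) ∩ c ⁻¹' s) := by
  have hIoo : Icc q (q + 1) ∩ c ⁻¹' s ⊆ Ioo q (q + 1) := fun t ht =>
    hc.mem_Ioo_of_ne ht.1 fun h => hq (h ▸ ht.2)
  have hcompact : IsCompact (Icc q (q + 1) ∩ c ⁻¹' s) :=
    isCompact_Icc.inter_right (hclosed.preimage hc.continuous)
  have hpre := isPreconnected_inter_preimage hcompact hc.continuous.continuousOn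
    ((hc.injOn_Ico q).mono (hIoo.trans Ioo_subset_Ico_self)) hs fun x hx => by
      obtain ⟨t, ht, rfl⟩ := hc.exists_mem_Ico (hsub hx) q
      exact mem_image_of_mem c ⟨Ico_subset_Icc_self ht, hx⟩
  rwa [inter_assoc, inter_self] at hpre

end IsSimpleLoop

variable {V : Type*} [NormedAddCommGroup V]

theorem IsSimpleLoop.sub_eq_sub_of_segment {W : Type*} [NormedAddCommGroup W] [NormedSpace ℝ W]
    {c : ℝ → W} (hc : IsSimpleLoop c) {j : W → W → V} {η : ℝ} (hη : 0 < η) {x y : W} {G : W → V}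
    (hG : IsPrimitiveAt j (segment ℝ x y) η G) (hsub : segment ℝ x y ⊆ range c) {q : ℝ}
    (hq : c q ∉ segment ℝ x y) {g : ℝ → V}
    (hg : IsPrimitiveAt (fun t t' => j (c t) (c t')) (Icc q (q + 1)) η g) {a b : ℝ}
    (ha : a ∈ Icc q (q + 1)) (hb : b ∈ Icc q (q + 1)) (hx : c a = x) (hy : c b = y) :
    G y - G x = g b - g a := by
  subst hx hy
  exact hG.sub_eq_sub_of_isPreconnected hη (hg.mono inter_subset_left le_rfl)
    (hc.isPreconnected_preimage (convex_segment _ _).isPreconnected (isCompact_segment _ _).isClosed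
      hsub hq) hc.continuous.continuousOn (fun t ht => ht.2) ⟨ha, left_mem_segment ℝ _ _⟩
    ⟨hb, right_mem_segment ℝ _ _⟩

theorem IsSimpleLoop.add_one_sub_eq {W : Type*} [PseudoMetricSpace W] {c : ℝ → W}
    (hc : IsSimpleLoop c) {j : W → W → V} {η : ℝ} (hη : 0 < η) {g : ℝ → V}
    (hg : IsPrimitiveAt (fun t t' => j (c t) (c t')) (Icc 0 3) η g) {t : ℝ}
    (ht : t ∈ Icc (0 : ℝ) 2) : g (t + 1) - g t = g 1 - g 0 := by
  have hshift : IsPrimitiveAt (fun t t' => j (c t) (c t')) (Icc 0 2) η fun t => g (t + 1) :=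
    fun s hs s' hs' hss => by
      have h := hg (s + 1) ⟨by linarith [hs.1], by linarith [hs.2]⟩ (s' + 1)
        ⟨by linarith [hs'.1], by linarith [hs'.2]⟩ (by rwa [dist_add_right])
      simpa only [hc.periodic _] using h
  have h := hshift.sub_eq_sub_of_isPreconnected hη (c := id)
    (hg.mono (Icc_subset_Icc le_rfl (by norm_num)) le_rfl) isPreconnected_Icc continuousOn_id
    (mapsTo_id _) (t := 0) (by norm_num) ht
  simpa only [id_eq, zero_add] using sub_eq_sub_iff_sub_eq_sub.1 h

namespace TriangulatedSurface

variable {N : ℕ} {K : TriangulatedSurface N} {j : (Fin N → ℝ) → (Fin N → ℝ) → V} {η θ : ℝ}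
  {c : ℝ → Fin N → ℝ} {u v : Fin N}

-- The increments along interior edges cancel and those along the sides of a triangle add up to
-- zero; the chain sum makes the increment along an edge independent of the triangle.
theorem exists_boundary_increments (hη : 0 < η) (hj : IsLocalCocycle j K.carrier η) :
    ∃ I : Fin N → Fin N → V, ∑ p ∈ K.boundaryEdges, I p.1 p.2 = 0 ∧
      ∀ p ∈ K.boundaryEdges, ∃ G, IsPrimitiveAt j (segment ℝ (vertex p.1) (vertex p.2)) (η / 2) G ∧
        I p.1 p.2 = G (vertex p.2) - G (vertex p.1) := by
  choose! G hG using fun s (hs : s ∈ K.tri) =>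
    (hj.mono (convexHull_subset_carrier hs)).exists_primitive hη (convex_convexHull ℝ _)
      ((Set.toFinite _).isCompact_convexHull ℝ).isBounded
  obtain ⟨C, hC⟩ := Metric.isBounded_iff.1 (Set.finite_range (vertex (N := N))).isBounded
  obtain ⟨m, hm, hmη⟩ := exists_nat_pos_div_lt C (half_pos hη)
  have hchain : ∀ s ∈ K.tri, ∀ u v, segment ℝ (vertex u) (vertex v) ⊆
      convexHull ℝ {vertex s.1, vertex s.2.1, vertex s.2.2} →
      chainSum j m (vertex u) (vertex v) = G s (vertex v) - G s (vertex u) := fun s hs u v hsub =>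
    (hG s hs).chainSum_eq hsub hm ((div_le_div_of_nonneg_right
      (hC (mem_range_self u) (mem_range_self v)) m.cast_nonneg).trans_lt hmη)
  have hside : ∀ s ∈ K.tri, ∀ u v, IsSideOf u v s →
      chainSum j m (vertex u) (vertex v) = G s (vertex v) - G s (vertex u) := fun s hs u v h =>
    hchain s hs u v (segment_subset_convexHull h)
  refine ⟨fun u v => chainSum j m (vertex u) (vertex v), ?_, fun p hp => ?_⟩
  · rw [sum_boundaryEdges (I := fun u v => chainSum j m (vertex u) (vertex v)) fun s hs u v h => ?_]
    · refine Finset.sum_eq_zero fun s hs => ?_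
      rw [hside s hs _ _ (Or.inl ⟨rfl, rfl⟩), hside s hs _ _ (Or.inr (Or.inl ⟨rfl, rfl⟩)),
        hside s hs _ _ (Or.inr (Or.inr ⟨rfl, rfl⟩))]
      abel
    · rw [hside s hs u v h, neg_sub,
        hchain s hs v u (segment_symm ℝ (vertex u) (vertex v) ▸ segment_subset_convexHull h)]
  · obtain ⟨⟨s, hs, h⟩, -⟩ := mem_boundaryEdges.1 hp
    exact ⟨G s, (hG s hs).mono (segment_subset_convexHull h) le_rfl, hside s hs _ _ h⟩

theorem exists_mem_Ioo_eq_midpoint (hc : IsSimpleLoop c) (huv : u ≠ v)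
    (hsub : segment ℝ (vertex u) (vertex v) ⊆ range c) {q : ℝ}
    (hq : c q ∉ segment ℝ (vertex u) (vertex v)) :
    ∃ a ∈ Icc q (q + 1), ∃ b ∈ Icc q (q + 1), ∃ t, (t ∈ Ioo a b ∨ t ∈ Ioo b a) ∧
      c a = vertex u ∧ c b = vertex v ∧ c t = midpoint ℝ (vertex u) (vertex v) := by
  obtain ⟨a, ha, hau⟩ := hc.exists_mem_Ico (hsub (left_mem_segment ℝ _ _)) q
  obtain ⟨b, hb, hbv⟩ := hc.exists_mem_Ico (hsub (right_mem_segment ℝ _ _)) q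
  have hconn : OrdConnected (Icc q (q + 1) ∩ c ⁻¹' segment ℝ (vertex u) (vertex v)) :=
    (hc.isPreconnected_preimage (convex_segment _ _).isPreconnected (isCompact_segment _ _).isClosed
      hsub hq).ordConnected
  have hab := hconn.uIcc_subset (x := a) (y := b)
    ⟨Ico_subset_Icc_self ha, hau ▸ left_mem_segment ℝ _ _⟩
    ⟨Ico_subset_Icc_self hb, hbv ▸ right_mem_segment ℝ _ _⟩
  have hca : c a v = 0 := by simp [hau, vertex, huv.symm]
  have hcb : c b v = 1 := by simp [hbv, vertex]
  obtain ⟨t, ht, (htv : c t v = 1 / 2)⟩ : (1 / 2 : ℝ) ∈ (fun t => c t v) '' uIcc a b := by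
    refine intermediate_value_uIcc (continuous_pi_iff.1 hc.continuous v).continuousOn ?_
    simp only [hca, hcb]
    rw [uIcc_of_le zero_le_one]
    norm_num
  refine ⟨a, Ico_subset_Icc_self ha, b, Ico_subset_Icc_self hb, t, ?_, hau, hbv, ?_⟩
  · have hta : t ≠ a := by rintro rfl; norm_num [hca] at htv
    have htb : t ≠ b := by rintro rfl; norm_num [hcb] at htv
    grind [mem_uIcc]
  · rw [eq_lineMap_of_mem_segment huv (hab ht).2, htv, one_div]
    rfl

theorem sub_eq_sub_of_boundaryEdge_ne (hη : 0 < η) (hc : IsSimpleLoop c)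
    (hrange : range c = K.boundary) {I : Fin N → Fin N → V}
    (hI : ∑ p ∈ K.boundaryEdges, I p.1 p.2 = 0)
    (hIG : ∀ p ∈ K.boundaryEdges, ∃ G, IsPrimitiveAt j (segment ℝ (vertex p.1) (vertex p.2)) η G ∧
      I p.1 p.2 = G (vertex p.2) - G (vertex p.1)) {g : ℝ → V} (huv : K.IsBoundaryEdge u v) {t : ℝ}
    (ht : c t = midpoint ℝ (vertex u) (vertex v))
    (hg : IsPrimitiveAt (fun t t' => j (c t) (c t')) (Icc t (t + 1)) η g) {a b : ℝ}
    (ha : a ∈ Ioo t (t + 1)) (hb : b ∈ Ioo t (t + 1)) (hau : c a = vertex u)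
    (hbv : c b = vertex v) : I u v = g b - g a := by
  have hexists : ∀ w, ∃ s, vertex w ∈ range c → s ∈ Ico t (t + 1) ∧ c s = vertex w := fun w => by
    by_cases hw : vertex w ∈ range c
    · obtain ⟨s, hs, h⟩ := hc.exists_mem_Ico hw t
      exact ⟨s, fun _ => ⟨hs, h⟩⟩
    · exact ⟨0, fun h => (hw h).elim⟩
  choose r hr using hexists
  have hsub : ∀ {u v}, K.IsBoundaryEdge u v → segment ℝ (vertex u) (vertex v) ⊆ range c :=
    fun h => hrange ▸ h.segment_subset
  have hru : r u = a := by
    obtain ⟨hmem, h⟩ := hr u (hau ▸ mem_range_self a)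
    exact hc.injOn_Ico t hmem (Ioo_subset_Ico_self ha) (h.trans hau.symm)
  have hrv : r v = b := by
    obtain ⟨hmem, h⟩ := hr v (hbv ▸ mem_range_self b)
    exact hc.injOn_Ico t hmem (Ioo_subset_Ico_self hb) (h.trans hbv.symm)
  rw [eq_sub_of_sum_boundaryEdges_eq_zero hI (fun w => g (r w)) huv fun p hp hne => ?_, hru, hrv]
  have hpe := mem_boundaryEdges.1 hp
  obtain ⟨G, hG, hIp⟩ := hIG p hp
  obtain ⟨hmem₁, h₁⟩ := hr p.1 (hsub hpe (left_mem_segment ℝ _ _))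
  obtain ⟨hmem₂, h₂⟩ := hr p.2 (hsub hpe (right_mem_segment ℝ _ _))
  rw [hIp]
  exact hc.sub_eq_sub_of_segment hη hG (hsub hpe)
    (ht ▸ huv.midpoint_notMem_segment hpe hne) hg (Ico_subset_Icc_self hmem₁)
    (Ico_subset_Icc_self hmem₂) h₁ h₂

theorem exists_isBoundaryEdge_notMem (hc : IsSimpleLoop c) (hrange : range c = K.boundary) :
    ∃ u v, K.IsBoundaryEdge u v ∧ ∃ q ∈ Ico (0 : ℝ) 1, c q ∉ segment ℝ (vertex u) (vertex v) := by
  obtain ⟨u, v, huv, -⟩ : c 0 ∈ K.boundary := hrange ▸ mem_range_self 0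
  obtain ⟨p, hp, hne⟩ := huv.exists_ne
  have hpe := mem_boundaryEdges.1 hp
  obtain ⟨q, hq, hcq⟩ := hc.exists_mem_Ico
    (hrange ▸ hpe.segment_subset (midpoint_mem_segment _ _)) 0
  exact ⟨u, v, huv, q, by rwa [zero_add] at hq,
    hcq ▸ hpe.midpoint_notMem_segment (p := (u, v)) huv hne.symm⟩

-- The increment of the cocycle along one boundary edge is computed twice: directly on the arc over
-- this edge, and, with the loop cut at the midpoint of the edge, from all the other edges. The two
-- values differ by one period.
theorem eq_of_isPrimitiveAt_boundary_loop (hη : 0 < η) (hj : IsLocalCocycle j K.carrier η)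
    (hc : IsSimpleLoop c) (hrange : range c = K.boundary) {g : ℝ → V} (hθ : 0 < θ)
    (hg : IsPrimitiveAt (fun t t' => j (c t) (c t')) (Icc 0 3) θ g) : g 1 = g 0 := by
  obtain ⟨I, hI, hIG⟩ := exists_boundary_increments hη hj
  obtain ⟨μ, hμ, hμη, hμθ⟩ : ∃ μ > 0, μ ≤ η / 2 ∧ μ ≤ θ :=
    ⟨min (η / 2) θ, lt_min (half_pos hη) hθ, min_le_left _ _, min_le_right _ _⟩
  replace hIG : ∀ p ∈ K.boundaryEdges,
      ∃ G, IsPrimitiveAt j (segment ℝ (vertex p.1) (vertex p.2)) μ G ∧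
        I p.1 p.2 = G (vertex p.2) - G (vertex p.1) := fun p hp =>
    (hIG p hp).imp fun G h => ⟨h.1.mono subset_rfl hμη, h.2⟩
  have hgμ : ∀ {q : ℝ}, q ∈ Icc (0 : ℝ) 2 →
      IsPrimitiveAt (fun t t' => j (c t) (c t')) (Icc q (q + 1)) μ g := fun hq =>
    hg.mono (Icc_subset_Icc hq.1 (by linarith [hq.2])) hμθ
  obtain ⟨u, v, huv, q, hq, hqe⟩ := exists_isBoundaryEdge_notMem hc hrange
  obtain ⟨a, ha, b, hb, t, ht, hau, hbv, hct⟩ :=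
    exists_mem_Ioo_eq_midpoint hc huv.ne (hrange ▸ huv.segment_subset) hqe
  obtain ⟨G, hG, hIuv⟩ := hIG (u, v) (mem_boundaryEdges.2 huv)
  have harc : I u v = g b - g a := hIuv.trans (hc.sub_eq_sub_of_segment hμ hG
    (hrange ▸ huv.segment_subset) hqe (hgμ ⟨hq.1, by linarith [hq.2]⟩) ha hb hau hbv)
  have hperiod : ∀ s ∈ Icc q (q + 1), g (s + 1) - g s = g 1 - g 0 := fun s hs =>
    hc.add_one_sub_eq hθ hg ⟨hq.1.trans hs.1, by linarith [hs.2, hq.2]⟩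
  have htI : t ∈ Icc (0 : ℝ) 2 := by
    rcases ht with ht | ht <;>
      exact ⟨by linarith [hq.1, ha.1, hb.1, ht.1], by linarith [hq.2, ha.2, hb.2, ht.2]⟩
  have hcut := fun {a' b' : ℝ} => sub_eq_sub_of_boundaryEdge_ne (a := a') (b := b') hμ hc hrange hI
    hIG huv hct (hgμ htI)
  rcases ht with ht | ht
  · have h := hcut (a' := a + 1) (b' := b) ⟨by linarith [hb.2, ht.2, ha.1], by linarith [ht.1]⟩
      ⟨ht.2, by linarith [hb.2, ha.1, ht.1]⟩ ((hc.periodic a).trans hau) hbv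
    rw [← sub_eq_zero, ← hperiod a ha, sub_eq_zero]
    exact sub_right_injective (h.symm.trans harc)
  · have h := hcut (a' := a) (b' := b + 1) ⟨ht.2, by linarith [ha.2, hb.1, ht.1]⟩
      ⟨by linarith [ha.2, hb.1, ht.2], by linarith [ht.1]⟩ hau ((hc.periodic b).trans hbv)
    rw [← sub_eq_zero, ← hperiod b hb, sub_eq_zero]
    exact sub_left_injective (h.symm.trans harc)

end TriangulatedSurface

end Loop

/-! ### Curve integrals -/

section CurveIntegral

theorem exists_isSimpleLoop_lift {X E : Type*} [TopologicalSpace X] [NormedAddCommGroup E]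
    {B : Set X} (hB : IsCompact B) {f : X → E} (hf : ContinuousOn f B) (hinj : InjOn f B)
    {γ : ℝ → E} (hγ : IsRectifiableJordanCurve γ) (himage : f '' B = γ '' Icc 0 1) :
    ∃ c : ℝ → X, IsSimpleLoop c ∧ range c = B ∧ ∀ t ∈ Icc (0 : ℝ) 1, f (c t) = γ t := by
  have hfract : ∀ t : ℝ, Int.fract t ∈ Ico (0 : ℝ) 1 := fun t =>
    ⟨Int.fract_nonneg t, Int.fract_lt_one t⟩
  have hγfract : ∀ t ∈ Icc (0 : ℝ) 1, γ (Int.fract t) = γ t := fun t ht => by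
    rcases ht.2.eq_or_lt with rfl | hlt
    · simpa using hγ.closed
    · rw [Int.fract_eq_self.2 ⟨ht.1, hlt⟩]
  have hlift : ∀ t : ℝ, ∃ x : B, f x = γ (Int.fract t) := fun t => by
    obtain ⟨x, hx, h⟩ : γ (Int.fract t) ∈ f '' B :=
      himage ▸ mem_image_of_mem _ (Ico_subset_Icc_self (hfract t))
    exact ⟨⟨x, hx⟩, h⟩
  choose c hc using hlift
  have : CompactSpace B := isCompact_iff_compactSpace.1 hB
  have hemb : IsClosedEmbedding (B.domRestrict f) :=
    hf.domRestrict.isClosedEmbedding (injOn_iff_injective.1 hinj)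
  have hcont : Continuous c := hemb.isInducing.continuous_iff.2
    ((hγ.continuousOn.comp_fract'' hγ.closed).congr fun t => (hc t).symm)
  refine ⟨fun t => c t, ⟨continuous_subtype_val.comp hcont, fun t => ?_, fun t t' h => ?_⟩,
    (range_subset_iff.2 fun t => (c t).2).antisymm fun x hx => ?_,
    fun t ht => (hc t).trans (hγfract t ht)⟩
  · exact hinj (c _).2 (c _).2 (by rw [hc, hc, Int.fract_add_one])
  · refine Int.fract_eq_fract.1 (hγ.injOn (hfract t) (hfract t') ?_)
    rw [← hc, ← hc, h]
  · obtain ⟨t, ht, h⟩ : f x ∈ γ '' Icc 0 1 := himage ▸ mem_image_of_mem _ hx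
    exact ⟨t, hinj (c t).2 hx (by rw [hc, hγfract t ht, h])⟩

theorem monotoneOn_Iic_of_le_succ {α : Type*} [Preorder α] {p : ℕ} {t : ℕ → α}
    (ht : ∀ i < p, t i ≤ t (i + 1)) : MonotoneOn t (Iic p) :=
  monotoneOn_of_le_add_one ordConnected_Iic fun i _ _ hi => ht i hi

theorem sum_norm_sub_le_variation {E : Type*} [NormedAddCommGroup E] {γ : ℝ → E} {s : Set ℝ}
    (hγ : BoundedVariationOn γ s) {p : ℕ} {t : ℕ → ℝ} (ht : MonotoneOn t (Iic p))
    (hmem : ∀ i ≤ p, t i ∈ s) :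
    ∑ i ∈ Finset.range p, ‖γ (t (i + 1)) - γ (t i)‖ ≤ (eVariationOn γ s).toReal := by
  have h := ENNReal.toReal_mono hγ (eVariationOn.sum_le_of_monotoneOn_Iic (f := γ) ht hmem)
  rw [ENNReal.toReal_sum (fun _ _ => edist_ne_top _ _)] at h
  simpa only [← dist_edist, dist_eq_norm] using h

variable {E V : Type*} [NormedAddCommGroup E] [NormedSpace ℝ E] [NormedAddCommGroup V]
  [NormedSpace ℝ V]

/-- The Riemann–Stieltjes integral of `Φ dζ` along `γ` exists and equals `I`, where the product of
an increment `h` of `γ` and a value `u` of `Φ` is `Λ h u`. -/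
def HasStieltjesIntegral (Λ : E →L[ℝ] V →L[ℝ] V) (Φ : E → V) (γ : ℝ → E) (I : V) : Prop :=
  ∀ ε > (0 : ℝ), ∃ δ > (0 : ℝ), ∀ (p : ℕ) (t τ : ℕ → ℝ), t 0 = 0 → t p = 1 →
    (∀ i < p, t i ≤ τ i ∧ τ i ≤ t (i + 1) ∧ t (i + 1) - t i < δ) →
    ‖∑ i ∈ Finset.range p, Λ (γ (t (i + 1)) - γ (t i)) (Φ (γ (τ i))) - I‖ < ε

variable {Λ : E →L[ℝ] V →L[ℝ] V} {Φ : E → V} {Ω C : Set E}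

theorem exists_isLocalCocycle_segmentIntegral [CompleteSpace V]
    (hΛ : ∀ h h' u, Λ h (Λ h' u) = Λ h' (Λ h u)) (hΩ : IsOpen Ω) (hΦ : ContinuousOn Φ Ω)
    (hder : ∀ x ∈ Ω, ∃ d, HasGateauxDeriv Λ Φ d x) (hC : IsCompact C) (hCΩ : C ⊆ Ω) :
    ∃ r > 0, IsLocalCocycle (segmentIntegral Λ Φ) C r := by
  obtain ⟨r, hr, hrΩ⟩ := hC.exists_thickening_subset_open hΩ hCΩ
  refine ⟨r, hr, fun x hx y _ z _ hxy _ hxz => ?_⟩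
  have hball : Metric.ball x r ⊆ Ω := (Metric.ball_subset_thickening hx r).trans hrΩ
  exact segmentIntegral_add_of_convex hΛ (convex_ball x r) (hΦ.mono hball)
    (fun w hw => hder w (hball hw)) (Metric.mem_ball_self hr) (Metric.mem_ball'.2 hxy)
    (Metric.mem_ball'.2 hxz)

theorem exists_norm_segmentIntegral_sub_le [CompleteSpace V] (hΩ : IsOpen Ω)
    (hΦ : ContinuousOn Φ Ω) (hC : IsCompact C) (hCΩ : C ⊆ Ω) {ε : ℝ} (hε : 0 < ε) :
    ∃ ρ > 0, ∀ x ∈ C, ∀ y z, dist x y < ρ → dist x z < ρ →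
      ‖segmentIntegral Λ Φ x y - Λ (y - x) (Φ z)‖ ≤ ‖Λ‖ * ‖y - x‖ * ε := by
  obtain ⟨ρ₁, hρ₁, hρΩ⟩ := hC.exists_thickening_subset_open hΩ hCΩ
  obtain ⟨ρ₂, hρ₂, hρΦ⟩ := Metric.mem_uniformity_dist.1 <|
    hC.uniformContinuousAt_of_continuousAt Φ
      (fun x hx => hΦ.continuousAt (hΩ.mem_nhds (hCΩ hx)))
      (Metric.dist_mem_uniformity (half_pos hε))
  refine ⟨min ρ₁ ρ₂, lt_min hρ₁ hρ₂, fun x hx y z hy hz => ?_⟩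
  have hsegment : ∀ s ∈ Icc (0 : ℝ) 1, x + s • (y - x) ∈ Metric.ball x (min ρ₁ ρ₂) := fun s hs =>
    (convex_ball x _).add_smul_sub_mem (Metric.mem_ball_self (lt_min hρ₁ hρ₂))
      (Metric.mem_ball'.2 hy) hs
  refine norm_segmentIntegral_sub_le (hΦ.comp (by fun_prop) fun s hs => hρΩ ?_) fun s hs => ?_
  · exact Metric.ball_subset_thickening hx _
      (Metric.ball_subset_ball (min_le_left _ _) (hsegment s hs))
  · have hxs : dist (Φ x) (Φ (x + s • (y - x))) < ε / 2 :=
      hρΦ ((Metric.mem_ball'.1 (hsegment s hs)).trans_le (min_le_right _ _)) hx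
    have hxz : dist (Φ x) (Φ z) < ε / 2 := hρΦ (hz.trans_le (min_le_right _ _)) hx
    rw [← dist_eq_norm]
    linarith [dist_triangle_left (Φ (x + s • (y - x))) (Φ z) (Φ x)]

theorem hasStieltjesIntegral_of_isPrimitiveAt [CompleteSpace V] (hΩ : IsOpen Ω)
    (hΦ : ContinuousOn Φ Ω) {γ : ℝ → E} (hγ : ContinuousOn γ (Icc 0 1))
    (hγΩ : γ '' Icc 0 1 ⊆ Ω) (hvar : BoundedVariationOn γ (Icc 0 1)) {θ : ℝ} (hθ : 0 < θ)
    {g : ℝ → V} (hg : IsPrimitiveAt (fun t t' => segmentIntegral Λ Φ (γ t) (γ t')) (Icc 0 1) θ g) :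
    HasStieltjesIntegral Λ Φ γ (g 1 - g 0) := by
  intro ε hε
  obtain ⟨κ, hκ, hκε⟩ := exists_pos_mul_lt hε (‖Λ‖ * (eVariationOn γ (Icc 0 1)).toReal)
  obtain ⟨ρ, hρ, happrox⟩ := exists_norm_segmentIntegral_sub_le (Λ := Λ) hΩ hΦ
    (isCompact_Icc.image_of_continuousOn hγ) hγΩ hκ
  obtain ⟨δ, hδ, hγδ⟩ := Metric.uniformContinuousOn_iff.1
    (isCompact_Icc.uniformContinuousOn_of_continuous hγ) ρ hρ
  refine ⟨min δ θ, lt_min hδ hθ, fun p t τ h0 h1 hpart => ?_⟩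
  have hmono : MonotoneOn t (Iic p) :=
    monotoneOn_Iic_of_le_succ fun i hi => (hpart i hi).1.trans (hpart i hi).2.1
  have hmem : ∀ i ≤ p, t i ∈ Icc (0 : ℝ) 1 := fun i hi =>
    ⟨h0 ▸ hmono p.zero_le hi i.zero_le, h1 ▸ hmono hi self_mem_Iic hi⟩
  have hterm : ∀ i < p, ‖Λ (γ (t (i + 1)) - γ (t i)) (Φ (γ (τ i))) - (g (t (i + 1)) - g (t i))‖ ≤
      ‖Λ‖ * ‖γ (t (i + 1)) - γ (t i)‖ * κ := fun i hi => by
    obtain ⟨hτ₁, hτ₂, hmesh⟩ := hpart i hi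
    obtain ⟨hmeshδ, hmeshθ⟩ := lt_min_iff.1 hmesh
    have hτ : τ i ∈ Icc (0 : ℝ) 1 := ⟨(hmem i hi.le).1.trans hτ₁, hτ₂.trans (hmem (i + 1) hi).2⟩
    have hdist : ∀ {s : ℝ}, t i ≤ s → dist (t i) s = s - t i := fun h => by
      rw [dist_comm, Real.dist_eq, abs_of_nonneg (sub_nonneg.2 h)]
    rw [hg _ (hmem i hi.le) _ (hmem (i + 1) hi) (by rwa [hdist (hτ₁.trans hτ₂)]), norm_sub_rev]
    refine happrox _ (mem_image_of_mem γ (hmem i hi.le)) _ _ (hγδ _ (hmem i hi.le) _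
      (hmem (i + 1) hi) ?_) (hγδ _ (hmem i hi.le) _ hτ ?_)
    · rwa [hdist (hτ₁.trans hτ₂)]
    · rw [hdist hτ₁]; linarith
  have htelescope : g 1 - g 0 = ∑ i ∈ Finset.range p, (g (t (i + 1)) - g (t i)) := by
    rw [Finset.sum_range_sub (fun i => g (t i)), h0, h1]
  calc _ ≤ ∑ i ∈ Finset.range p, ‖Λ‖ * ‖γ (t (i + 1)) - γ (t i)‖ * κ := by
        rw [htelescope, ← Finset.sum_sub_distrib]
        exact norm_sum_le_of_le _ fun i hi => hterm i (Finset.mem_range.1 hi)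
    _ ≤ ‖Λ‖ * (eVariationOn γ (Icc 0 1)).toReal * κ := by
        rw [← Finset.sum_mul, ← Finset.mul_sum]
        gcongr
        exact sum_norm_sub_le_variation hvar hmono hmem
    _ < ε := hκε

theorem theorem1_general [CompleteSpace V] (hΛ : ∀ h h' u, Λ h (Λ h' u) = Λ h' (Λ h u))
    (hΩ : IsOpen Ω) (hΦ : ContinuousOn Φ Ω) (hder : ∀ ζ ∈ Ω, ∃ d, HasGateauxDeriv Λ Φ d ζ)
    {N : ℕ} {K : TriangulatedSurface N} {f : (Fin N → ℝ) → E} (hf : ContinuousOn f K.carrier)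
    (hfΩ : f '' K.carrier ⊆ Ω) {γ : ℝ → E} (hγ : IsRectifiableJordanCurve γ)
    (hedge : IsEdgeOf γ K f) : HasStieltjesIntegral Λ Φ γ 0 := by
  have hbK := K.boundary_subset_carrier
  obtain ⟨c, hc, hrange, hfc⟩ := exists_isSimpleLoop_lift K.isCompact_boundary
    (hf.mono hbK) hedge.1 hγ hedge.2
  have hcK : ∀ t, c t ∈ K.carrier := fun t => hbK (hrange ▸ mem_range_self t)
  obtain ⟨r, hr, hcocycle⟩ := exists_isLocalCocycle_segmentIntegral hΛ hΩ hΦ hder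
    (K.isCompact_carrier.image_of_continuousOn hf) hfΩ
  obtain ⟨η, hη, hj⟩ := hcocycle.exists_comp hr
    (K.isCompact_carrier.uniformContinuousOn_of_continuous hf) (mapsTo_image f K.carrier)
  obtain ⟨θ, hθ, hjc⟩ := hj.exists_comp hη (isCompact_Icc.uniformContinuousOn_of_continuous
    hc.continuous.continuousOn) fun t (_ : t ∈ Icc (0 : ℝ) 3) => hcK t
  obtain ⟨g, hg⟩ := hjc.exists_primitive hθ (convex_Icc _ _) (Metric.isBounded_Icc _ _)
  have hgγ : IsPrimitiveAt (fun t t' => segmentIntegral Λ Φ (γ t) (γ t')) (Icc 0 1) (θ / 2) g :=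
    fun t ht t' ht' h => by
      simpa only [hfc t ht, hfc t' ht'] using
        hg.mono (Icc_subset_Icc_right (by norm_num)) le_rfl t ht t' ht' h
  have hγΩ : γ '' Icc 0 1 ⊆ Ω := hedge.2 ▸ (image_mono hbK).trans hfΩ
  rw [← sub_eq_zero_of_eq (TriangulatedSurface.eq_of_isPrimitiveAt_boundary_loop hη hj hc hrange
    (half_pos hθ) hg)]
  exact hasStieltjesIntegral_of_isPrimitiveAt hΩ hΦ hγ.continuousOn hγΩ hγ.rectifiable
    (half_pos hθ) hgγ

end CurveIntegral

section RealSpan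

variable {A : Type*} [NormedCommRing A] [NormedAlgebra ℂ A] {k : ℕ}

/-- The multiplication of elements of the algebra by vectors of the real span, as a bilinear
map. -/
noncomputable def spanMul (e : Fin k → A) : realSpan e →L[ℝ] A →L[ℝ] A :=
  (ContinuousLinearMap.mul ℝ A).comp (realSpan e).subtypeL

theorem hasCurveIntegral_iff {e : Fin k → A} {Φ : realSpan e → A} {γ : ℝ → realSpan e} {I : A} :
    HasCurveIntegral Φ γ I ↔ HasStieltjesIntegral (spanMul e) Φ γ I := by
  simp only [HasCurveIntegral, mul_comm (Φ _)]
  rfl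

end RealSpan

theorem theorem1 {A : Type*} [NormedCommRing A] [NormedAlgebra ℂ A] [FiniteDimensional ℂ A]
    {k : ℕ} (hk : 2 ≤ k) (e : Fin k → A) (he : LinearIndependent ℝ e)
    (he_one : e ⟨0, by omega⟩ = 1)
    (Ω : Set (realSpan e)) (hΩ_open : IsOpen Ω) (hΩ_conn : IsConnected Ω)
    (Φ : realSpan e → A) (hΦ : IsMonogenicOn Φ Ω)
    {N : ℕ} (K : TriangulatedSurface N) (f : (Fin N → ℝ) → realSpan e)
    (hf : IsPiecewiseSmoothSurface K f) (hfΩ : f '' K.carrier ⊆ Ω)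
    (γ : ℝ → realSpan e) (hγ : IsRectifiableJordanCurve γ) (hedge : IsEdgeOf γ K f) :
    HasCurveIntegral Φ γ 0 := by
  have : CompleteSpace A := FiniteDimensional.complete ℂ A
  exact hasCurveIntegral_iff.2 (theorem1_general (Λ := spanMul e)
    (fun h h' u => mul_left_comm (h : A) h' u) hΩ_open hΦ.1 hΦ.2 hf.continuousOn hfΩ hγ hedge)
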